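/- Let $\mathfrak h$ be a separable complex Hilbert space (inner product linear in the second argument) and $\mathcal B=\mathcal B(\mathfrak h)$. Let $-G$ be the generator of a $C_0$-semigroup of contractions $(W_t)_{t\ge0}$ on $\mathfrak h$. Let $\phi$ be a linear map from $\mathcal B$ to the sesquilinear forms on $\operatorname{dom}G$ which is completely positive, i.e. $\sum_{i,j}\phi(x_i^*x_j)[u_i,u_j]\ge0$ for all finite families $(x_i)\subset\mathcal B$, $(u_i)\subset\operatorname{dom}G$, and normal, i.e. $\phi(\sup_\alpha x_\alpha)[u,u]=\sup_\alpha\phi(x_\alpha)[u,u]$ for every $u\in\operatorname{dom}G$ and every bounded increasing net $(x_\alpha)$ of positive elements of $\mathcal B$. Put $$\mathcal L(x)[u,v]=\phi(x)[u,v]-\langle Gu,xv\rangle-\langle u,xGv\rangle ,\qquad u,v\in\operatorname{dom}G,\ x\in\mathcal B,$$ and assume $\mathcal L(I)[u,u]\le0$ for all $u\in\operatorname{dom}G$. Let $P^{(1)}_t(x)=W_t^*xW_t$ and, for $n\ge2$, let $P^{(n)}_t(x)\in\mathcal B$ be given by $$\langle u,P^{(n)}_t(x)v\rangle=\langle u,W_t^*xW_tv\rangle+\int_0^t\phi\big(P^{(n-1)}_\tau(x)\big)[W_{t-\tau}u,W_{t-\tau}v]\,d\tau,\qquad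 u,v\in\operatorname{dom}G.$$ The minimal semigroup is $P^{\min}_t(x)=\lim_nP^{(n)}_t(x)$ in the weak operator sense (the supremum of the increasing sequence $P^{(n)}_t(x)$ if $x\ge0$); it is called conservative if $P^{\min}_t(I)=I$ for all $t\ge0$. For $\lambda>0$ and $x\in\mathcal B$ let $Q_\lambda(x)\in\mathcal B$ be given by $$\langle u,Q_\lambda(x)v\rangle=\int_0^\infty e^{-\lambda t}\phi(x)[W_tu,W_tv]\,dt,\qquad u,v\in\operatorname{dom}G,$$ let $Q^n_\lambda$ be the $n$-th iterate of the map $Q_\lambda:\mathcal B\to\mathcal B$, and let $$\ell_\lambda(I)=\int_0^\infty e^{-\lambda t}(I-W_t^*W_t)\,dt-\frac1\lambda Q_\lambda(I)$$ (integral in the weak sense). Suppose in addition that $\mathcal L(I)[u,v]=0$ for all $u,v\in\operatorname{dom}G$. Then for every $\lambda>0$: $\ell_\lambda(I)=0$; the limit $\lim_nQ^n_\lambda(I)$ exists in the strong and in the $*$-weak ($\sigma$-weak) topology; and the Laplace transform $\tilde{\mathcal E}_\lambda(I)$ of $\mathcal E_t(I)=I-P^{\min}_t(I)$, defined by $\langle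 u,\tilde{\mathcal E}_\lambda(I)v\rangle=\int_0^\infty e^{-\lambda t}\langle u,\mathcal E_t(I)v\rangle\,dt$ for $u,v\in\mathfrak h$ (with convergent integrals), satisfies $$\tilde{\mathcal E}_\lambda(I)=\frac1\lambda\lim_nQ^n_\lambda(I).$$ Hence, for every $\lambda>0$, $(P^{\min}_t)_{t\ge0}$ is conservative if and only if $\lim_nQ^n_\lambda(I)=0$. -/

import Mathlib

open scoped ComplexOrder NNReal InnerProductSpace
open Filter Topology MeasureTheory

noncomputable section

namespace MinimalQDS

variable {H : Type*} [NormedAddCommGroup H] [InnerProductSpace ℂ H] [CompleteSpace H]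

/-- A `C₀`-semigroup of contractions on `H`. -/
structure ContractionSemigroup (H : Type*) [NormedAddCommGroup H] [InnerProductSpace ℂ H] where
  toFun : ℝ≥0 → H →L[ℂ] H
  map_zero : toFun 0 = 1
  map_add : ∀ s t, toFun (s + t) = toFun s * toFun t
  norm_le_one : ∀ t, ‖toFun t‖ ≤ 1
  strong_continuity : ∀ u, Tendsto (fun t => toFun t u) (𝓝 0) (𝓝 u)

/-- `A` is the infinitesimal generator of the semigroup `W`: its domain consists of exactly those
`u` for which `lim_{t → 0+} (W_t u - u) / t` exists, and `A u` is this limit. -/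
def IsGenerator (A : H →ₗ.[ℂ] H) (W : ContractionSemigroup H) : Prop :=
  ∀ u y : H, (u, y) ∈ A.graph ↔
    Tendsto (fun t : ℝ≥0 => ((t : ℝ)⁻¹ : ℂ) • (W.toFun t u - u)) (𝓝[>] 0) (𝓝 y)

/-- Sesquilinear forms on a subspace, conjugate linear in the first argument. -/
abbrev SesqForm (D : Submodule ℂ H) := D →ₗ⋆[ℂ] D →ₗ[ℂ] ℂ

/-- The data of a formal generator `𝓛(x)[u,v] = φ(x)[u,v] - ⟨Gu, xv⟩ - ⟨u, xGv⟩`, `u, v ∈ dom G`: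
`-G` generates the contraction semigroup `W`; `φ` is linear, completely positive and normal, with
values in the sesquilinear forms on `dom G`; and `𝓛(1)[u,u] ≤ 0` on `dom G`. -/
structure FormalGenerator (H : Type*) [NormedAddCommGroup H] [InnerProductSpace ℂ H]
    [CompleteSpace H] where
  G : H →ₗ.[ℂ] H
  W : ContractionSemigroup H
  generates : IsGenerator (-G) W
  φ : (H →L[ℂ] H) →ₗ[ℂ] SesqForm G.domain
  completely_positive : ∀ (n : ℕ) (u : Fin n → G.domain) (x : Fin n → H →L[ℂ] H),
    0 ≤ ∑ i, ∑ j, φ (star (x i) * x j) (u i) (u j)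
  /- Normality: suprema of bounded increasing nets (directed sets) of positive operators, in the
  Loewner order, are preserved by the quadratic forms. -/
  normal : ∀ (u : G.domain) (S : Set (H →L[ℂ] H)) (s : H →L[ℂ] H),
    S.Nonempty → DirectedOn (· ≤ ·) S → (∀ x ∈ S, 0 ≤ x) → IsLUB S s →
      IsLUB ((fun x => (φ x u u).re) '' S) (φ s u u).re
  dissipative : ∀ u : G.domain, φ 1 u u - ⟪G u, (u : H)⟫_ℂ - ⟪(u : H), G u⟫_ℂ ≤ 0

/-- The bounded operator `T` with `⟨e i, T (e j)⟩ = B i j` for all `i, j` (for `e` with dense range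
there is at most one), and `0` if there is none. -/
def opOfForm {ι : Type*} (e : ι → H) (B : ι → ι → ℂ) : H →L[ℂ] H :=
  open Classical in
  if h : ∃ T : H →L[ℂ] H, ∀ i j, ⟪e i, T (e j)⟫_ℂ = B i j then h.choose else 0

/-- `T` is the Laplace transform at `lam` of the operator family `F`, in the weak sense:
`⟨u, T v⟩ = ∫_0^∞ exp (-lam t) ⟨u, F_t v⟩ dt`, with convergent integrals. -/
def IsLaplaceTransform (lam : ℝ) (F : ℝ≥0 → H →L[ℂ] H) (T : H →L[ℂ] H) : Prop :=
  ∀ u v : H,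
    IntegrableOn (fun t : ℝ => (Real.exp (-(lam * t)) : ℂ) * ⟪u, F t.toNNReal v⟫_ℂ) (Set.Ioi 0) ∧
    ⟪u, T v⟫_ℂ = ∫ t in Set.Ioi (0 : ℝ), (Real.exp (-(lam * t)) : ℂ) * ⟪u, F t.toNNReal v⟫_ℂ

/-- The Laplace transform of a family of bounded operators (`0` if it does not exist). -/
def laplaceTransform (lam : ℝ) (F : ℝ≥0 → H →L[ℂ] H) : H →L[ℂ] H :=
  open Classical in
  if h : ∃ T : H →L[ℂ] H, IsLaplaceTransform lam F T then h.choose else 0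

/-- Convergence in the strong operator topology. -/
def TendstoStrong (A : ℕ → H →L[ℂ] H) (T : H →L[ℂ] H) : Prop :=
  ∀ u : H, Tendsto (fun n => A n u) atTop (𝓝 (T u))

/-- Convergence in the `*`-weak (`σ`-weak, ultraweak) topology. Every trace class operator has the
form `ρ = ∑ₖ |b k⟩⟨a k|` with square summable sequences `a`, `b` of vectors, every such series is
trace class, and `tr (ρ x) = ∑ₖ ⟨a k, x (b k)⟩`. -/
def TendstoUltraweak (A : ℕ → H →L[ℂ] H) (T : H →L[ℂ] H) : Prop :=
  ∀ a b : ℕ → H, Summable (fun k => ‖a k‖ ^ 2) → Summable (fun k => ‖b k‖ ^ 2) →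
    Tendsto (fun n => ∑' k, ⟪a k, A n (b k)⟫_ℂ) atTop (𝓝 (∑' k, ⟪a k, T (b k)⟫_ℂ))

namespace FormalGenerator

variable (L : FormalGenerator H)

/-- The sesquilinear form `𝓛(x)[u,v]` on `dom G`. -/
def form (x : H →L[ℂ] H) (u v : L.G.domain) : ℂ :=
  L.φ x u v - ⟪L.G u, x (v : H)⟫_ℂ - ⟪(u : H), x (L.G v)⟫_ℂ

/-- The semigroup `W` leaves `dom G` invariant. -/
theorem W_mem_domain (t : ℝ≥0) (u : L.G.domain) : L.W.toFun t (u : H) ∈ L.G.domain := by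
  have h1 : ((u : H), (-L.G) u) ∈ (-L.G).graph := LinearPMap.mem_graph (-L.G) u
  have h2 := (L.generates _ _).1 h1
  have h3 := ((L.W.toFun t).continuous.tendsto _).comp h2
  have h4 : (L.W.toFun t (u : H), L.W.toFun t ((-L.G) u)) ∈ (-L.G).graph := by
    refine (L.generates _ _).2 (h3.congr fun s => ?_)
    have h5 : L.W.toFun t (L.W.toFun s (u : H)) = L.W.toFun s (L.W.toFun t (u : H)) := by
      have h6 := L.W.map_add t s
      rw [add_comm, L.W.map_add s t] at h6
      exact (DFunLike.congr_fun h6 (u : H)).symm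
    simp [h5]
  obtain ⟨y, hy, -⟩ := (LinearPMap.mem_graph_iff _).1 h4
  have h7 : L.W.toFun t (u : H) = (y : H) := hy.symm
  rw [h7]
  exact y.2

/-- `W_t u` as an element of `dom G`, for `u ∈ dom G`. -/
def orbit (t : ℝ≥0) (u : L.G.domain) : L.G.domain := ⟨L.W.toFun t u, L.W_mem_domain t u⟩

/-- The iterates `P⁽ⁿ⁾_t(x)` of the construction of the minimal semigroup: the bounded operators
with `P⁽ⁿ⁾_t(x)[u,v] = ⟨u, W_t* x W_t v⟩ + ∫_0^t φ(P⁽ⁿ⁻¹⁾_τ(x))[W_{t-τ} u, W_{t-τ} v] dτ` for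
`u, v ∈ dom G`. With `P⁽⁰⁾ = 0`, this gives `P⁽¹⁾_t(x) = W_t* x W_t`. -/
def iter : ℕ → ℝ≥0 → (H →L[ℂ] H) → (H →L[ℂ] H)
  | 0, _, _ => 0
  | n + 1, t, x => opOfForm (fun u : L.G.domain => (u : H)) fun u v =>
      ⟪(u : H), (star (L.W.toFun t) * x * L.W.toFun t) (v : H)⟫_ℂ +
        ∫ τ in (0 : ℝ)..t, L.φ (iter n τ.toNNReal x)
          (L.orbit ((t : ℝ) - τ).toNNReal u) (L.orbit ((t : ℝ) - τ).toNNReal v)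

/-- The minimal semigroup `P^min_t(x) = lim_n P⁽ⁿ⁾_t(x)`, as a weak operator limit. For `x ≥ 0` the
sequence is increasing and bounded, and this limit is its supremum. -/
def Pmin (t : ℝ≥0) (x : H →L[ℂ] H) : H →L[ℂ] H :=
  opOfForm (fun u : H => u) fun u v => limUnder atTop fun n => ⟪u, L.iter n t x v⟫_ℂ

/-- The minimal semigroup is conservative (Markovian, unital). -/
def IsConservative : Prop := ∀ t : ℝ≥0, L.Pmin t 1 = 1

/-- `𝓔_t(I) = I - P^min_t(I)`. -/
def explosion (t : ℝ≥0) : H →L[ℂ] H := 1 - L.Pmin t 1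

/-- `𝓔⁽ⁿ⁾_t(I) = I - P⁽ⁿ⁾_t(I)`. -/
def explosionIter (n : ℕ) (t : ℝ≥0) : H →L[ℂ] H := 1 - L.iter n t 1

/-- The map `Q_λ`: `Q_λ(x)` is the bounded operator with
`Q_λ(x)[u,v] = ∫_0^∞ exp (-λ t) φ(x)[W_t u, W_t v] dt` for `u, v ∈ dom G`. -/
def Q (lam : ℝ) (x : H →L[ℂ] H) : H →L[ℂ] H :=
  opOfForm (fun u : L.G.domain => (u : H)) fun u v =>
    ∫ t in Set.Ioi (0 : ℝ),
      (Real.exp (-(lam * t)) : ℂ) * L.φ x (L.orbit t.toNNReal u) (L.orbit t.toNNReal v)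

/-- `ℓ_λ(I)`: the Laplace transform of `𝓔⁽¹⁾_t(I) = I - W_t* W_t`, minus `(1/λ) Q_λ(I)`. -/
def ell (lam : ℝ) : H →L[ℂ] H :=
  laplaceTransform lam (L.explosionIter 1) - ((lam : ℂ)⁻¹) • L.Q lam 1

end FormalGenerator

end MinimalQDS

end

set_option linter.unusedSectionVars false

noncomputable section

namespace MinimalQDS

/-! ### Positive sesquilinear forms: polarization and integration. -/

section Forms

variable {V : Type*} [AddCommGroup V] [Module ℂ V]

/-! Let `X n` be the operator `λ ∫₀^∞ exp(-λt) P⁽ⁿ⁾_t(I) dt`, with `P⁽⁰⁾ = 0`. Everything follows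
from `Q_λ(I - X n) = I - X (n+1)`, which by iteration gives `Q_λⁿ(I) = I - X n`. On the diagonal
this identity has two ingredients.

Since `𝓛(I) = 0`, the function `φ(I)[W_s u, W_s u]` is minus the right derivative of `‖W_s u‖²`, so
integration by parts gives `Q_λ(I)[u,u] = ‖u‖² - λ ∫ exp(-λs) ‖W_s u‖² ds`
(`integral_exp_rate_one`).

Next, `φ` is moved inside the integral defining `X n`. The resulting double integral is the Laplace
transform of the convolution in the recursion for `P⁽ⁿ⁺¹⁾`, so `Q_λ(X n)[u,u] = ⟨u, X (n+1) u⟩ - λ ∫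
exp(-λs) ‖W_s u‖² ds`. The exchange (`laplace_exchange`) rests on monotonicity: `t ↦ P⁽ⁿ⁾_t(I)` is
decreasing with values in `[0, I]`, so its Laplace integral lies between two Riemann sums in the
Loewner order, and any positive functional preserves this squeeze. Subtracting gives
`integral_rate_one_sub`, and polarization gives `Q_one_sub`.

As `n` grows, `X n` increases to the average `Y` of `P^min_t(I)`, so `Q_λⁿ(I)` decreases strongly to
`I - Y`, which is `λ` times the Laplace transform of `I - P^min_t(I)`. The limit vanishes exactly
when `Y = I`, which for a decreasing family bounded by `I` forces `P^min_t(I) = I` for every `t`. -/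

theorem sesq_polarization (B : V →ₗ⋆[ℂ] V →ₗ[ℂ] ℂ) (u v : V) :
    B u v = (1 / 4 : ℂ) * (B (u + v) (u + v) - B (u - v) (u - v)
      - Complex.I * B (u + Complex.I • v) (u + Complex.I • v)
      + Complex.I * B (u - Complex.I • v) (u - Complex.I • v)) := by
  simp only [map_add, map_sub, LinearMap.add_apply, LinearMap.sub_apply, map_smul,
    LinearMap.map_smulₛₗ, LinearMap.smul_apply, smul_eq_mul, Complex.conj_I]
  linear_combination ((1 / 2) * B u v - (1 / 2) * B v u) * Complex.I_sq

theorem sesq_ext_diag {B C : V →ₗ⋆[ℂ] V →ₗ[ℂ] ℂ} (h : ∀ u, B u u = C u u) : B = C := by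
  ext u v
  rw [sesq_polarization B, sesq_polarization C]
  simp only [h]

/-- Nonnegativity in the order of `ℂ` includes reality of the diagonal. Exchanging the arguments
fixes the two real terms of the polarization formula and swaps the two imaginary ones, which
conjugation undoes. -/
theorem sesq_conj_symm {B : V →ₗ⋆[ℂ] V →ₗ[ℂ] ℂ} (hB : ∀ u, 0 ≤ B u u) (u v : V) :
    (starRingEnd ℂ) (B v u) = B u v := by
  have hr : ∀ w, (starRingEnd ℂ) (B w w) = B w w := fun w =>
    Complex.conj_eq_iff_im.2 (Complex.le_def.1 (hB w)).2.symm
  rw [sesq_polarization B u v]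
  have h1 : B (v + u) (v + u) = B (u + v) (u + v) := by rw [add_comm]
  have h2 : B (v - u) (v - u) = B (u - v) (u - v) := by
    rw [← neg_sub u v, map_neg, map_neg, LinearMap.neg_apply, neg_neg]
  have h3 : B (v + Complex.I • u) (v + Complex.I • u)
      = B (u - Complex.I • v) (u - Complex.I • v) := by
    have : v + Complex.I • u = Complex.I • (u - Complex.I • v) := by
      rw [smul_sub, smul_smul, Complex.I_mul_I]; simp [add_comm]
    rw [this]
    simp only [map_smul, LinearMap.map_smulₛₗ, LinearMap.smul_apply, smul_eq_mul, Complex.conj_I]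
    rw [← mul_assoc]; simp
  have h4 : B (v - Complex.I • u) (v - Complex.I • u)
      = B (u + Complex.I • v) (u + Complex.I • v) := by
    have : v - Complex.I • u = (-Complex.I) • (u + Complex.I • v) := by
      rw [smul_add, smul_smul, neg_mul, Complex.I_mul_I]; simp [add_comm, sub_eq_add_neg]
    rw [this]
    simp only [map_smul, LinearMap.map_smulₛₗ, LinearMap.smul_apply, smul_eq_mul, map_neg,
      Complex.conj_I]
    rw [← mul_assoc]; simp
  rw [sesq_polarization B v u, h1, h2, h3, h4]
  have e1 := hr (u + v)
  have e2 := hr (u - v)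
  have e3 := hr (u + Complex.I • v)
  have e4 := hr (u - Complex.I • v)
  generalize B (u + v) (u + v) = a1 at *
  generalize B (u - v) (u - v) = a2 at *
  generalize B (u + Complex.I • v) (u + Complex.I • v) = a3 at *
  generalize B (u - Complex.I • v) (u - Complex.I • v) = a4 at *
  simp only [map_mul, map_add, map_sub, e1, e2, e3, e4, Complex.conj_I, map_div₀, map_one,
    map_ofNat]
  ring

/-- Cauchy–Schwarz for positive semidefinite sesquilinear forms. -/
theorem sesq_cauchy_schwarz {B : V →ₗ⋆[ℂ] V →ₗ[ℂ] ℂ} (hB : ∀ u, 0 ≤ B u u) (u v : V) :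
    ‖B u v‖ ^ 2 ≤ (B u u).re * (B v v).re := by
  -- The form may be degenerate, so it is only a pre-inner product.
  let c : PreInnerProductSpace.Core ℂ V :=
    { inner := fun u v => B u v
      conj_inner_symm := fun u v => sesq_conj_symm hB u v
      re_inner_nonneg := fun u => (Complex.le_def.1 (hB u)).1
      add_left := fun u v w => by simp
      smul_left := fun u v r => by simp }
  have h := @InnerProductSpace.Core.inner_mul_inner_self_le ℂ V _ _ _ c u v
  have h2 : ‖B v u‖ = ‖B u v‖ := by rw [← sesq_conj_symm hB u v, RCLike.norm_conj]
  change ‖B u v‖ * ‖B v u‖ ≤ (B u u).re * (B v v).re at h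
  rw [h2] at h
  rwa [sq]

theorem sesq_norm_le {B : V →ₗ⋆[ℂ] V →ₗ[ℂ] ℂ} (hB : ∀ u, 0 ≤ B u u) {p : V → ℝ}
    (hp : ∀ u, 0 ≤ p u) (h : ∀ u, (B u u).re ≤ p u ^ 2) (u v : V) : ‖B u v‖ ≤ p u * p v := by
  refine abs_le_of_sq_le_sq' ?_ (mul_nonneg (hp u) (hp v)) |>.2
  refine (sesq_cauchy_schwarz hB u v).trans ?_
  rw [mul_pow]
  exact mul_le_mul (h u) (h v) (Complex.le_def.1 (hB v)).1 (sq_nonneg _)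

theorem sesq_integrable {α : Type*} [MeasurableSpace α] {μ : Measure α}
    {B : α → V →ₗ⋆[ℂ] V →ₗ[ℂ] ℂ} (hB : ∀ u, Integrable (fun s => B s u u) μ) (u v : V) :
    Integrable (fun s => B s u v) μ := by
  have h : (fun s => B s u v) = fun s => (1 / 4 : ℂ) * (B s (u + v) (u + v) - B s (u - v) (u - v)
      - Complex.I * B s (u + Complex.I • v) (u + Complex.I • v)
      + Complex.I * B s (u - Complex.I • v) (u - Complex.I • v)) :=
    funext fun s => sesq_polarization (B s) u v
  rw [h]
  exact ((((hB _).sub (hB _)).sub ((hB _).const_mul _)).add ((hB _).const_mul _)).const_mul _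

/-- The integral of a family of sesquilinear forms. -/
def formIntegral {α : Type*} [MeasurableSpace α] (μ : Measure α) (B : α → V →ₗ⋆[ℂ] V →ₗ[ℂ] ℂ)
    (hB : ∀ u, Integrable (fun s => B s u u) μ) : V →ₗ⋆[ℂ] V →ₗ[ℂ] ℂ :=
  LinearMap.mk₂'ₛₗ (starRingEnd ℂ) (RingHom.id ℂ) (fun u v => ∫ s, B s u v ∂μ)
    (fun u u' v => by
      simp only [map_add, LinearMap.add_apply]
      exact integral_add (sesq_integrable hB _ _) (sesq_integrable hB _ _))
    (fun c u v => by
      simp only [LinearMap.map_smulₛₗ, LinearMap.smul_apply, smul_eq_mul]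
      exact integral_const_mul _ _)
    (fun u v v' => by
      simp only [map_add]
      exact integral_add (sesq_integrable hB _ _) (sesq_integrable hB _ _))
    (fun c u v => by
      simp only [map_smul, smul_eq_mul, RingHom.id_apply]
      exact integral_const_mul _ _)

theorem formIntegral_apply {α : Type*} [MeasurableSpace α] {μ : Measure α}
    {B : α → V →ₗ⋆[ℂ] V →ₗ[ℂ] ℂ} (hB : ∀ u, Integrable (fun s => B s u u) μ) (u v : V) :
    formIntegral μ B hB u v = ∫ s, B s u v ∂μ := rfl

end Forms

variable {H : Type*} [NormedAddCommGroup H] [InnerProductSpace ℂ H] [CompleteSpace H]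

/-! ### Loewner order and quadratic forms. -/

theorem op_nonneg_iff {T : H →L[ℂ] H} : 0 ≤ T ↔ ∀ u, 0 ≤ ⟪u, T u⟫_ℂ := by
  rw [ContinuousLinearMap.nonneg_iff_isPositive]
  refine ⟨fun h u => h.inner_nonneg_right u, fun h => ?_⟩
  rw [ContinuousLinearMap.isPositive_iff_complex]
  intro u
  have h1 := Complex.le_def.1 (h u)
  rw [← inner_conj_symm] at h1
  simp only [Complex.zero_re, Complex.conj_re, Complex.zero_im, Complex.conj_im] at h1
  refine ⟨?_, h1.1⟩
  apply Complex.ext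
  · simp
  · simp; linarith [h1.2]

theorem op_le_iff {S T : H →L[ℂ] H} : S ≤ T ↔ ∀ u, ⟪u, S u⟫_ℂ ≤ ⟪u, T u⟫_ℂ := by
  rw [← sub_nonneg, op_nonneg_iff]
  simp

theorem re_inner_mono {S T : H →L[ℂ] H} (h : S ≤ T) (u : H) :
    (⟪u, S u⟫_ℂ).re ≤ (⟪u, T u⟫_ℂ).re := (Complex.le_def.1 (op_le_iff.1 h u)).1

theorem re_inner_nonneg {T : H →L[ℂ] H} (h : 0 ≤ T) (u : H) :
    0 ≤ (⟪u, T u⟫_ℂ).re := (Complex.le_def.1 (op_nonneg_iff.1 h u)).1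

theorem inner_eq_re {T : H →L[ℂ] H} (h : 0 ≤ T) (u : H) :
    ⟪u, T u⟫_ℂ = ((⟪u, T u⟫_ℂ).re : ℂ) :=
  Complex.ext rfl (by simpa using (Complex.le_def.1 (op_nonneg_iff.1 h u)).2.symm)

theorem re_inner_le_norm_sq {T : H →L[ℂ] H} (h : T ≤ 1) (u : H) :
    (⟪u, T u⟫_ℂ).re ≤ ‖u‖ ^ 2 := by
  have := re_inner_mono h u
  simpa [inner_self_eq_norm_sq_to_K, ← Complex.ofReal_pow] using this

/-- The sesquilinear form of an operator. -/
def opForm (T : H →L[ℂ] H) : H →ₗ⋆[ℂ] H →ₗ[ℂ] ℂ :=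
  LinearMap.mk₂'ₛₗ (starRingEnd ℂ) (RingHom.id ℂ) (fun u v => ⟪u, T v⟫_ℂ)
    (fun _ _ _ => inner_add_left _ _ _) (fun _ _ _ => inner_smul_left _ _ _)
    (fun _ _ _ => by rw [map_add, inner_add_right])
    (fun _ _ _ => by rw [map_smul, inner_smul_right]; rfl)

theorem opForm_apply (T : H →L[ℂ] H) (u v : H) : opForm T u v = ⟪u, T v⟫_ℂ := rfl

theorem norm_inner_le_of_mem_unit {T : H →L[ℂ] H} (h0 : 0 ≤ T) (h1 : T ≤ 1) (u v : H) :
    ‖⟪u, T v⟫_ℂ‖ ≤ ‖u‖ * ‖v‖ :=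
  sesq_norm_le (B := opForm T) (op_nonneg_iff.1 h0) (fun u => norm_nonneg u)
    (re_inner_le_norm_sq h1) u v

/-- This is `T² ≤ T` on `[0, 1]`: Cauchy–Schwarz for the form of `T` at `T u` and `u` gives `‖T u‖⁴
≤ ‖T u‖² ⟨u, T u⟩`. It upgrades convergence of quadratic forms to strong convergence. -/
theorem norm_apply_sq_le {T : H →L[ℂ] H} (h0 : 0 ≤ T) (h1 : T ≤ 1) (u : H) :
    ‖T u‖ ^ 2 ≤ (⟪u, T u⟫_ℂ).re := by
  have h := sesq_cauchy_schwarz (B := opForm T) (op_nonneg_iff.1 h0) (T u) u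
  simp only [opForm_apply] at h
  have h2 : ‖⟪T u, T u⟫_ℂ‖ = ‖T u‖ ^ 2 := by simp [inner_self_eq_norm_sq_to_K]
  rw [h2] at h
  have h3 := re_inner_le_norm_sq h1 (T u)
  have h4 := re_inner_nonneg h0 u
  by_contra hc
  push Not at hc
  have h5 : 0 < ‖T u‖ ^ 2 := h4.trans_lt hc
  nlinarith

/-! ### Operators determined by a form on a dense subspace. -/

section OfForm

variable {V : Type*} [AddCommGroup V] [Module ℂ V]

theorem op_nonneg_of_dense {ι : Type*} {e : ι → H} (he : DenseRange e) {T : H →L[ℂ] H}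
    (h : ∀ u, 0 ≤ ⟪e u, T (e u)⟫_ℂ) : 0 ≤ T := by
  refine op_nonneg_iff.2 fun u => he.induction_on u ?_ h
  exact isClosed_le continuous_const (continuous_id.inner T.continuous)

theorem op_eq_of_dense {e : V →ₗ[ℂ] H} (he : DenseRange e) {S T : H →L[ℂ] H}
    (h : ∀ u, ⟪e u, S (e u)⟫_ℂ = ⟪e u, T (e u)⟫_ℂ) : S = T := by
  refine le_antisymm ?_ ?_
  · rw [← sub_nonneg]
    exact op_nonneg_of_dense he fun u => by simp [h]
  · rw [← sub_nonneg]
    exact op_nonneg_of_dense he fun u => by simp [h]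

/-- A positive form on a dense subspace, bounded by the norm, comes from an operator in `[0, 1]`. -/
theorem exists_operator_of_form {e : V →ₗ[ℂ] H} (he : DenseRange e) {B : V →ₗ⋆[ℂ] V →ₗ[ℂ] ℂ}
    (hB : ∀ u, 0 ≤ B u u) (hB1 : ∀ u, (B u u).re ≤ ‖e u‖ ^ 2) :
    ∃ T : H →L[ℂ] H, 0 ≤ T ∧ T ≤ 1 ∧ ∀ u v, ⟪e u, T (e v)⟫_ℂ = B u v := by
  have hb : ∀ u v, ‖B u v‖ ≤ ‖e u‖ * ‖e v‖ :=
    sesq_norm_le hB (fun _ => norm_nonneg _) hB1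
  -- Each functional `B u` extends to `H`; its Riesz vector `r u` is linear in `u` with `‖r u‖ ≤ ‖e
  -- u‖`, so `e u ↦ r u` extends to the required operator.
  let F : V → H →L[ℂ] ℂ := fun u => (B u).extendOfNorm e
  have hF : ∀ u v, F u (e v) = B u v := fun u v =>
    LinearMap.extendOfNorm_eq he ⟨_, hb u⟩ v
  let r : V → H := fun u => (InnerProductSpace.toDual ℂ H).symm (F u)
  have hr : ∀ u v, ⟪r u, e v⟫_ℂ = B u v := fun u v => by
    simp only [r, InnerProductSpace.toDual_symm_apply, hF]
  have hrn : ∀ u, ‖r u‖ ≤ 1 * ‖e u‖ := fun u => by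
    simp only [r, LinearIsometryEquiv.norm_map, one_mul]
    exact LinearMap.opNorm_extendOfNorm_le he (norm_nonneg _) (hb u)
  have hext : ∀ x y : H, (∀ v, ⟪x, e v⟫_ℂ = ⟪y, e v⟫_ℂ) → x = y := fun x y h => by
    refine ext_inner_right ℂ fun w => he.induction_on w ?_ h
    exact isClosed_eq (continuous_const.inner continuous_id) (continuous_const.inner continuous_id)
  let R : V →ₗ[ℂ] H :=
    { toFun := r
      map_add' := fun u u' => hext _ _ fun v => by simp [hr]
      map_smul' := fun c u => hext _ _ fun v => by simp [hr, mul_comm] }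
  let T : H →L[ℂ] H := R.extendOfNorm e
  have hT : ∀ u, T (e u) = r u := fun u => LinearMap.extendOfNorm_eq he ⟨1, hrn⟩ u
  have hTB : ∀ u v, ⟪e u, T (e v)⟫_ℂ = B u v := fun u v => by
    rw [hT, ← inner_conj_symm, hr, sesq_conj_symm hB]
  refine ⟨T, op_nonneg_of_dense he fun u => by rw [hTB]; exact hB u, ?_, hTB⟩
  rw [← sub_nonneg]
  refine op_nonneg_of_dense he fun u => ?_
  simp only [sub_apply, one_apply_eq_self, inner_sub_right, hTB,
    sub_nonneg]
  rw [Complex.le_def]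
  have h1 := hB1 u
  have h2 := (Complex.le_def.1 (hB u)).2
  simp only [inner_self_eq_norm_sq_to_K, Complex.coe_algebraMap, ← Complex.ofReal_pow,
    Complex.ofReal_re, Complex.ofReal_im]
  exact ⟨h1, h2.symm⟩

theorem opOfForm_spec {ι : Type*} {e : ι → H} {B : ι → ι → ℂ}
    (h : ∃ T : H →L[ℂ] H, ∀ i j, ⟪e i, T (e j)⟫_ℂ = B i j) (i j : ι) :
    ⟪e i, opOfForm e B (e j)⟫_ℂ = B i j := by
  rw [opOfForm, dif_pos h]
  exact h.choose_spec i j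

/-- Density makes the operator unique, so exhibiting one excludes the default value `0` of
`opOfForm`. `iter`, `Pmin` and `Q` are all evaluated this way. -/
theorem opOfForm_eq {e : V →ₗ[ℂ] H} (he : DenseRange e) {B : V → V → ℂ} {T : H →L[ℂ] H}
    (hT : ∀ i j, ⟪e i, T (e j)⟫_ℂ = B i j) : opOfForm (fun u => e u) B = T := by
  refine op_eq_of_dense he fun u => ?_
  rw [hT]
  exact opOfForm_spec (e := fun u => e u) ⟨T, hT⟩ u u

end OfForm

/-! ### Monotone limits in the strong and ultraweak topologies. -/

/-- The quadratic forms decrease and are bounded below, hence are Cauchy; `norm_apply_sq_le` applied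
to `A N - A n` makes the vectors `A n u` Cauchy. -/
theorem exists_strong_limit {A : ℕ → H →L[ℂ] H} (hA : Antitone A) (h0 : ∀ n, 0 ≤ A n)
    (h1 : ∀ n, A n ≤ 1) : ∃ S : H →L[ℂ] H, 0 ≤ S ∧ S ≤ 1 ∧ TendstoStrong A S := by
  have hc : ∀ u, CauchySeq fun n => A n u := fun u => by
    have hanti : Antitone fun n => (⟪u, A n u⟫_ℂ).re := fun m n h => re_inner_mono (hA h) u
    have hlim := tendsto_atTop_ciInf hanti ⟨0, by
      rintro _ ⟨n, rfl⟩; exact re_inner_nonneg (h0 n) u⟩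
    rw [Metric.cauchySeq_iff']
    intro ε hε
    obtain ⟨N, hN⟩ := Metric.cauchySeq_iff'.1 hlim.cauchySeq (ε ^ 2) (by positivity)
    refine ⟨N, fun n hn => ?_⟩
    have h2 := hN n hn
    have h3 := norm_apply_sq_le (T := A N - A n) (sub_nonneg.2 (hA hn))
      ((sub_le_self _ (h0 n)).trans (h1 N)) u
    rw [dist_comm, Real.dist_eq] at h2
    rw [dist_comm, dist_eq_norm]
    simp only [sub_apply, inner_sub_right, Complex.sub_re] at h3
    exact lt_of_pow_lt_pow_left₀ 2 hε.le ((h3.trans (le_abs_self _)).trans_lt h2)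
  choose f hf using fun u => cauchySeq_tendsto_of_complete (hc u)
  have hpi : Tendsto (fun n x => A n x) atTop (𝓝 f) := tendsto_pi_nhds.2 hf
  refine ⟨continuousLinearMapOfTendsto A hpi, ?_, ?_, hf⟩
  · refine op_nonneg_iff.2 fun u => ?_
    exact ge_of_tendsto' (tendsto_const_nhds.inner (hf u)) fun n => op_nonneg_iff.1 (h0 n) u
  · refine op_le_iff.2 fun u => ?_
    exact le_of_tendsto' (tendsto_const_nhds.inner (hf u)) fun n => op_le_iff.1 (h1 n) u

theorem TendstoStrong.tendstoUltraweak {A : ℕ → H →L[ℂ] H} {S : H →L[ℂ] H}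
    (h : TendstoStrong A S) (h0 : ∀ n, 0 ≤ A n) (h1 : ∀ n, A n ≤ 1) : TendstoUltraweak A S := by
  intro a b ha hb
  refine tendsto_tsum_of_dominated_convergence (bound := fun k => ‖a k‖ ^ 2 + ‖b k‖ ^ 2)
    (ha.add hb) (fun k => tendsto_const_nhds.inner (h (b k))) (Eventually.of_forall fun n k => ?_)
  refine (norm_inner_le_of_mem_unit (h0 n) (h1 n) (a k) (b k)).trans ?_
  nlinarith [sq_nonneg (‖a k‖ - ‖b k‖), sq_nonneg ‖a k‖, sq_nonneg ‖b k‖]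

/-! ### Contraction semigroups and density of the generator's domain. -/

namespace ContractionSemigroup

variable {H : Type*} [NormedAddCommGroup H] [InnerProductSpace ℂ H] (W : ContractionSemigroup H)

theorem norm_apply_le (t : ℝ≥0) (u : H) : ‖W.toFun t u‖ ≤ ‖u‖ := by
  simpa using (W.toFun t).le_of_opNorm_le (W.norm_le_one t) u

theorem add_apply (s t : ℝ≥0) (u : H) : W.toFun (s + t) u = W.toFun s (W.toFun t u) := by
  rw [W.map_add]; rfl

/-- The contraction at the smaller time factors out. Continuity at `0` thus yields two-sided
continuity at every time. -/
theorem norm_sub_le (s t : ℝ≥0) (u : H) :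
    ‖W.toFun s u - W.toFun t u‖ ≤ ‖W.toFun (nndist s t) u - u‖ := by
  wlog h : t ≤ s generalizing s t
  · rw [norm_sub_rev, nndist_comm]
    exact this t s (le_of_not_ge h)
  have h1 : s = t + nndist s t := by
    rw [NNReal.nndist_eq]
    rw [max_eq_left (by simp [tsub_eq_zero_of_le h]), add_tsub_cancel_of_le h]
  have h2 : W.toFun s u - W.toFun t u = W.toFun t (W.toFun (nndist s t) u - u) := by
    rw [map_sub, ← W.add_apply, ← h1]
  rw [h2]
  exact W.norm_apply_le _ _

theorem continuous_apply (u : H) : Continuous fun t => W.toFun t u := by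
  refine continuous_iff_continuousAt.2 fun t => ?_
  rw [ContinuousAt, tendsto_iff_norm_sub_tendsto_zero]
  refine squeeze_zero (fun _ => norm_nonneg _) (fun s => W.norm_sub_le s t u) ?_
  have h1 : Tendsto (fun s => nndist s t) (𝓝 t) (𝓝 0) := by
    have : Continuous fun s => nndist s t := continuous_id.nndist continuous_const
    simpa using this.tendsto t
  have h2 := ((W.strong_continuity u).comp h1).sub_const u
  simpa using h2.norm

theorem continuous_real (u : H) : Continuous fun t : ℝ => W.toFun t.toNNReal u :=
  (W.continuous_apply u).comp continuous_real_toNNReal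

end ContractionSemigroup

/-- The integrals `∫₀^ε W_s u ds` lie in the domain, and after division by `ε` they converge to `u`.
-/
theorem IsGenerator.dense_domain {A : H →ₗ.[ℂ] H} {W : ContractionSemigroup H}
    (hA : IsGenerator A W) : Dense (A.domain : Set H) := by
  intro u
  let w : ℝ → H := fun s => W.toFun s.toNNReal u
  have hw : Continuous w := W.continuous_real u
  let Φ : ℝ → H := fun t => ∫ s in (0 : ℝ)..t, w s
  have hΦ : ∀ t, HasDerivAt Φ (w t) t := fun t => hw.integral_hasStrictDerivAt 0 t |>.hasDerivAt
  have hΦ0 : Φ 0 = 0 := intervalIntegral.integral_same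
  have hw0 : w 0 = u := by simp [w, W.map_zero]
  have hcoe : Tendsto (fun t : ℝ≥0 => (t : ℝ)) (𝓝[>] 0) (𝓝[≠] 0) := by
    refine tendsto_nhdsWithin_iff.2 ⟨?_, ?_⟩
    · exact (NNReal.continuous_coe.tendsto 0).mono_left nhdsWithin_le_nhds
    · filter_upwards [self_mem_nhdsWithin] with t ht
      exact (NNReal.coe_pos.2 ht).ne'
  have hmem : ∀ ε : ℝ≥0, Φ ε ∈ A.domain := fun ε => by
    -- Applying `W_t` shifts the window of integration by `t`, so the difference quotient of the
    -- orbit of `Φ ε` is that of `t ↦ Φ (ε + t) - Φ t`.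
    have h1 : ∀ t : ℝ≥0, W.toFun t (Φ ε) - Φ ε = (Φ (ε + t) - Φ (0 + t)) - (Φ (ε + 0) - Φ 0) := by
      intro t
      have h2 : W.toFun t (Φ ε) = Φ (ε + t) - Φ (0 + t) := by
        have h3 : W.toFun t (Φ ε) = ∫ s in (0 : ℝ)..ε, W.toFun t (w s) :=
          ((W.toFun t).intervalIntegral_comp_comm (hw.intervalIntegrable _ _)).symm
        have h4 : ∫ s in (0 : ℝ)..ε, W.toFun t (w s) = ∫ s in (0 : ℝ)..ε, w (s + t) := by
          refine intervalIntegral.integral_congr fun s hs => ?_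
          rw [Set.uIcc_of_le (NNReal.coe_nonneg ε)] at hs
          simp only [w]
          rw [Real.toNNReal_add hs.1 (NNReal.coe_nonneg t), Real.toNNReal_coe, add_comm, W.add_apply]
        rw [h3, h4, intervalIntegral.integral_comp_add_right]
        exact (intervalIntegral.integral_interval_sub_left (hw.intervalIntegrable _ _)
          (hw.intervalIntegrable _ _)).symm
      rw [h2, hΦ0]
      simp
    have h5 : HasDerivAt (fun t => Φ (ε + t) - Φ t) (w ε - w 0) 0 := by
      refine HasDerivAt.sub ?_ (hΦ 0)
      have := hΦ (ε + 0)
      simpa using this.comp_const_add (ε : ℝ) 0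
    have h6 := (hasDerivAt_iff_tendsto_slope_zero.1 h5).comp hcoe
    have h7 : (Φ ε, w ε - w 0) ∈ A.graph := by
      refine (hA _ _).2 (h6.congr fun t => ?_)
      rw [h1]
      simp only [Function.comp_apply, zero_add]
      rw [← Complex.ofReal_inv, Complex.coe_smul]
    obtain ⟨y, hy, -⟩ := (LinearPMap.mem_graph_iff _).1 h7
    have h8 : Φ ε = (y : H) := hy.symm
    rw [h8]
    exact y.2
  have hlim := (hasDerivAt_iff_tendsto_slope_zero.1 (hΦ 0)).comp hcoe
  rw [hw0] at hlim
  refine mem_closure_of_tendsto hlim (Eventually.of_forall fun t => ?_)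
  simp only [Function.comp_apply, zero_add, hΦ0, sub_zero]
  rw [← Complex.coe_smul]
  exact A.domain.smul_mem _ (hmem t)

/-! ### The form `φ` along orbits of the semigroup. -/

namespace FormalGenerator

variable (L : FormalGenerator H)

theorem dense_domain : DenseRange (L.G.domain.subtype) := by
  have h := L.generates.dense_domain
  simp only [LinearPMap.neg_domain] at h
  simpa [DenseRange] using h

theorem G_orbit (t : ℝ≥0) (u : L.G.domain) : L.G (L.orbit t u) = L.W.toFun t (L.G u) := by
  have h1 : ((u : H), (-L.G) u) ∈ (-L.G).graph := LinearPMap.mem_graph (-L.G) u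
  have h2 := (L.generates _ _).1 h1
  have h3 := ((L.W.toFun t).continuous.tendsto _).comp h2
  have h4 : (L.W.toFun t (u : H), L.W.toFun t ((-L.G) u)) ∈ (-L.G).graph := by
    refine (L.generates _ _).2 (h3.congr fun s => ?_)
    have h5 : L.W.toFun t (L.W.toFun s (u : H)) = L.W.toFun s (L.W.toFun t (u : H)) := by
      rw [← L.W.add_apply, add_comm, L.W.add_apply]
    simp [h5]
  obtain ⟨y, hy, hy2⟩ := (LinearPMap.mem_graph_iff _).1 h4
  have h7 : L.orbit t u = y := Subtype.ext hy.symm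
  have h8 : (-L.G) y = L.W.toFun t ((-L.G) u) := hy2
  have h9 : -(L.G y) = L.W.toFun t (-(L.G u)) := h8
  rw [h7]
  rw [map_neg] at h9
  exact neg_injective h9

theorem orbit_add (t : ℝ≥0) (u v : L.G.domain) : L.orbit t (u + v) = L.orbit t u + L.orbit t v :=
  Subtype.ext (by simp [orbit])

theorem orbit_smul (t : ℝ≥0) (c : ℂ) (u : L.G.domain) : L.orbit t (c • u) = c • L.orbit t u :=
  Subtype.ext (by simp [orbit])

/-- The form `φ(x)[W_s u, W_s v]`. -/
def pull (x : H →L[ℂ] H) (s : ℝ) : SesqForm L.G.domain :=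
  LinearMap.mk₂'ₛₗ (starRingEnd ℂ) (RingHom.id ℂ)
    (fun u v => L.φ x (L.orbit s.toNNReal u) (L.orbit s.toNNReal v))
    (fun _ _ _ => by simp [orbit_add]) (fun _ _ _ => by simp [orbit_smul])
    (fun _ _ _ => by simp [orbit_add]) (fun _ _ _ => by simp [orbit_smul])

theorem pull_apply (x : H →L[ℂ] H) (s : ℝ) (u v : L.G.domain) :
    L.pull x s u v = L.φ x (L.orbit s.toNNReal u) (L.orbit s.toNNReal v) := rfl

theorem φ_nonneg {x : H →L[ℂ] H} (hx : 0 ≤ x) (u : L.G.domain) : 0 ≤ L.φ x u u := by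
  obtain ⟨y, rfl⟩ := CStarAlgebra.nonneg_iff_eq_star_mul_self.1 hx
  simpa using L.completely_positive 1 (fun _ => u) (fun _ => y)

theorem φ_mono {x y : H →L[ℂ] H} (h : x ≤ y) (u : L.G.domain) : L.φ x u u ≤ L.φ y u u := by
  have := L.φ_nonneg (sub_nonneg.2 h) u
  simpa using this

/-- The diagonal values `φ(x)[W_s u, W_s u]` as a positive real functional of `x`. -/
def rate (s : ℝ) (u : L.G.domain) : (H →L[ℂ] H) →ₗ[ℝ] ℝ where
  toFun x := (L.pull x s u u).re
  map_add' x y := by simp [pull_apply]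
  map_smul' c x := by
    have h : c • x = (c : ℂ) • x := (Complex.coe_smul c x).symm
    rw [h]
    simp [pull_apply]

theorem rate_apply (s : ℝ) (u : L.G.domain) (x : H →L[ℂ] H) :
    L.rate s u x = (L.pull x s u u).re := rfl

theorem rate_mono (s : ℝ) (u : L.G.domain) {x y : H →L[ℂ] H} (h : x ≤ y) :
    L.rate s u x ≤ L.rate s u y := (Complex.le_def.1 (L.φ_mono h _)).1

theorem rate_nonneg (s : ℝ) (u : L.G.domain) {x : H →L[ℂ] H} (h : 0 ≤ x) :
    0 ≤ L.rate s u x := (Complex.le_def.1 (L.φ_nonneg h _)).1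

theorem pull_nonneg {x : H →L[ℂ] H} (hx : 0 ≤ x) (s : ℝ) (u : L.G.domain) :
    0 ≤ L.pull x s u u := L.φ_nonneg hx _

theorem pull_self {x : H →L[ℂ] H} (hx : 0 ≤ x) (s : ℝ) (u : L.G.domain) :
    L.pull x s u u = (L.rate s u x : ℂ) :=
  Complex.ext rfl (by simpa using (Complex.le_def.1 (L.pull_nonneg hx s u)).2.symm)

variable {L}

/-- `𝓛(I) = 0` gives `φ(I)[u,u] = 2 Re ⟨G u, u⟩`. The bound is uniform along orbits, because `W`
contracts both `u` and `G u`. -/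
theorem φ_one_le (hL : ∀ u v : L.G.domain, L.form 1 u v = 0) (u : L.G.domain) :
    (L.φ 1 u u).re ≤ 2 * ‖L.G u‖ * ‖(u : H)‖ := by
  have h := hL u u
  simp only [form, one_apply_eq_self] at h
  have h2 : L.φ 1 u u = ⟪L.G u, (u : H)⟫_ℂ + ⟪(u : H), L.G u⟫_ℂ := by linear_combination h
  rw [h2, Complex.add_re]
  have h3 := (Complex.re_le_norm _).trans (norm_inner_le_norm (𝕜 := ℂ) (L.G u) (u : H))
  have h4 := (Complex.re_le_norm _).trans (norm_inner_le_norm (𝕜 := ℂ) (u : H) (L.G u))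
  nlinarith

theorem φ_le (hL : ∀ u v : L.G.domain, L.form 1 u v = 0) {x : H →L[ℂ] H} (hx : x ≤ 1)
    (u : L.G.domain) : (L.φ x u u).re ≤ 2 * ‖L.G u‖ * ‖(u : H)‖ :=
  (Complex.le_def.1 (L.φ_mono hx u)).1.trans (φ_one_le hL u)

theorem rate_le (hL : ∀ u v : L.G.domain, L.form 1 u v = 0) {x : H →L[ℂ] H} (hx : x ≤ 1)
    (s : ℝ) (u : L.G.domain) : L.rate s u x ≤ 2 * ‖L.G u‖ * ‖(u : H)‖ := by
  refine (φ_le hL hx _).trans ?_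
  rw [G_orbit]
  have h1 := L.W.norm_apply_le s.toNNReal (L.G u)
  have h2 := L.W.norm_apply_le s.toNNReal (u : H)
  have h3 : ((L.orbit s.toNNReal u : L.G.domain) : H) = L.W.toFun s.toNNReal (u : H) := rfl
  rw [h3]
  gcongr

/-- By `φ_le` and Cauchy–Schwarz the form `φ(x)` is continuous for the graph norm of `G`, and orbits
are continuous in that norm because `G` commutes with `W`. -/
theorem continuous_rate (hL : ∀ u v : L.G.domain, L.form 1 u v = 0) {x : H →L[ℂ] H} (h0 : 0 ≤ x)
    (hx : x ≤ 1) (u : L.G.domain) : Continuous fun s => L.rate s u x := by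
  refine continuous_iff_continuousAt.2 fun s₀ => ?_
  set a₀ := L.orbit s₀.toNNReal u with ha₀
  set a : ℝ → L.G.domain := fun s => L.orbit s.toNNReal u with ha
  set C := 2 * ‖L.G u‖ * ‖(u : H)‖ with hC
  have hC0 : 0 ≤ C := by positivity
  let δ : ℝ → ℝ := fun s => (L.φ x (a s - a₀) (a s - a₀)).re
  have hδ : Tendsto δ (𝓝 s₀) (𝓝 0) := by
    refine squeeze_zero (fun s => (Complex.le_def.1 (L.φ_nonneg h0 _)).1)
      (fun s => φ_le hL hx _) ?_
    have h1 : Continuous fun s : ℝ => 2 * ‖L.W.toFun s.toNNReal (L.G u)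
        - L.W.toFun s₀.toNNReal (L.G u)‖ * ‖L.W.toFun s.toNNReal (u : H)
        - L.W.toFun s₀.toNNReal (u : H)‖ :=
      ((((L.W.continuous_real _).sub continuous_const).norm).const_mul 2 |>.mul
        ((L.W.continuous_real _).sub continuous_const).norm)
    have h2 := h1.tendsto s₀
    simp only [sub_self, norm_zero, mul_zero] at h2
    refine h2.congr fun s => ?_
    have h3 : L.G (a s - a₀) = L.W.toFun s.toNNReal (L.G u) - L.W.toFun s₀.toNNReal (L.G u) := by
      rw [LinearPMap.map_sub, G_orbit, G_orbit]
    rw [h3]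
    rfl
  have hcs := fun v w => sesq_cauchy_schwarz (B := L.φ x) (L.φ_nonneg h0) v w
  -- `C` bounds the diagonal values at `a s` and at `a₀`, so Cauchy–Schwarz controls each of the two
  -- cross terms by `√(C * δ s)`.
  have hb : ∀ s, |L.rate s u x - L.rate s₀ u x| ≤ 2 * √(C * δ s) := fun s => by
    have hsplit : L.φ x (a s) (a s) - L.φ x a₀ a₀
        = L.φ x (a s) (a s - a₀) + L.φ x (a s - a₀) a₀ := by
      simp only [map_sub, LinearMap.sub_apply]; ring
    have hδ0 : 0 ≤ δ s := (Complex.le_def.1 (L.φ_nonneg h0 _)).1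
    have h1 : ‖L.φ x (a s) (a s - a₀)‖ ≤ √(C * δ s) :=
      Real.le_sqrt_of_sq_le ((hcs _ _).trans
        (mul_le_mul_of_nonneg_right (rate_le hL hx s u) hδ0))
    have h2 : ‖L.φ x (a s - a₀) a₀‖ ≤ √(C * δ s) := by
      refine Real.le_sqrt_of_sq_le ((hcs _ _).trans ?_)
      rw [mul_comm]
      exact mul_le_mul_of_nonneg_right (rate_le hL hx s₀ u) hδ0
    have h3 : L.rate s u x - L.rate s₀ u x = (L.φ x (a s) (a s) - L.φ x a₀ a₀).re := by
      rw [Complex.sub_re]; rfl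
    rw [h3]
    refine (Complex.abs_re_le_norm _).trans ?_
    rw [hsplit]
    exact (norm_add_le _ _).trans (by linarith)
  have hs : Tendsto (fun s => 2 * √(C * δ s)) (𝓝 s₀) (𝓝 0) := by
    have := ((hδ.const_mul C).sqrt).const_mul 2
    simpa using this
  rw [ContinuousAt, tendsto_iff_norm_sub_tendsto_zero]
  exact squeeze_zero (fun _ => norm_nonneg _) hb hs

/-- The generator is a limit from the right, so a right derivative comes out directly; the
fundamental theorem of calculus used below asks for no more. -/
theorem hasDerivWithinAt_orbit (u : L.G.domain) {s : ℝ} (hs : 0 ≤ s) :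
    HasDerivWithinAt (fun t : ℝ => L.W.toFun t.toNNReal (u : H))
      (-(L.W.toFun s.toNNReal (L.G u))) (Set.Ioi s) s := by
  rw [hasDerivWithinAt_iff_tendsto_slope' (by simp)]
  have h1 : ((u : H), (-L.G) u) ∈ (-L.G).graph := LinearPMap.mem_graph (-L.G) u
  have h2 := ((L.W.toFun s.toNNReal).continuous.tendsto _).comp ((L.generates _ _).1 h1)
  have h3 : Tendsto (fun b : ℝ => (b - s).toNNReal) (𝓝[>] s) (𝓝[>] 0) := by
    refine tendsto_nhdsWithin_iff.2 ⟨?_, ?_⟩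
    · have : Continuous fun b : ℝ => (b - s).toNNReal :=
        continuous_real_toNNReal.comp (continuous_id.sub continuous_const)
      have h := this.tendsto s
      simp only [sub_self, Real.toNNReal_zero] at h
      exact h.mono_left nhdsWithin_le_nhds
    · filter_upwards [self_mem_nhdsWithin] with b hb
      exact Real.toNNReal_pos.2 (sub_pos.2 hb)
  have h4 := h2.comp h3
  have h5 : L.W.toFun s.toNNReal ((-L.G) u) = -(L.W.toFun s.toNNReal (L.G u)) := by
    rw [← map_neg]; rfl
  rw [h5] at h4
  refine h4.congr' ?_
  filter_upwards [self_mem_nhdsWithin] with b hb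
  have hb' : 0 ≤ b - s := (sub_pos.2 hb).le
  have h6 : b.toNNReal = s.toNNReal + (b - s).toNNReal := by
    rw [← Real.toNNReal_add hs hb']; congr 1; ring
  simp only [Function.comp_apply, slope_def_module, map_smul, map_sub]
  rw [h6, L.W.add_apply, Real.coe_toNNReal _ hb', ← Complex.ofReal_inv, Complex.coe_smul]

/-- The derivative is `-2 Re ⟨G W_s u, W_s u⟩`, which `𝓛(I) = 0` at `W_s u` identifies with
`-φ(I)[W_s u, W_s u]`. -/
theorem hasDerivWithinAt_norm_sq (hL : ∀ u v : L.G.domain, L.form 1 u v = 0) (u : L.G.domain)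
    {s : ℝ} (hs : 0 ≤ s) : HasDerivWithinAt (fun t : ℝ => ‖L.W.toFun t.toNNReal (u : H)‖ ^ 2)
      (-(L.rate s u 1)) (Set.Ioi s) s := by
  have h1 := hasDerivWithinAt_orbit u hs
  have h2 := h1.inner ℂ h1
  have h3 := Complex.reCLM.hasFDerivAt.comp_hasDerivWithinAt s h2
  have h4 := hL (L.orbit s.toNNReal u) (L.orbit s.toNNReal u)
  simp only [form, one_apply_eq_self, G_orbit] at h4
  have h5 : -(L.rate s u 1) = Complex.reCLM (⟪L.W.toFun s.toNNReal (u : H),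
      -(L.W.toFun s.toNNReal (L.G u))⟫_ℂ + ⟪-(L.W.toFun s.toNNReal (L.G u)),
      L.W.toFun s.toNNReal (u : H)⟫_ℂ) := by
    rw [rate_apply, pull_apply]
    have h6 : L.φ 1 (L.orbit s.toNNReal u) (L.orbit s.toNNReal u)
      = ⟪L.W.toFun s.toNNReal (L.G u), L.W.toFun s.toNNReal (u : H)⟫_ℂ
        + ⟪L.W.toFun s.toNNReal (u : H), L.W.toFun s.toNNReal (L.G u)⟫_ℂ := by
      rw [sub_sub, sub_eq_zero] at h4
      exact h4
    rw [h6]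
    simp only [inner_neg_left, inner_neg_right, Complex.reCLM_apply, Complex.add_re, Complex.neg_re]
    ring
  rw [h5]
  refine h3.congr (fun t _ => ?_) ?_ <;>
  · simp [inner_self_eq_norm_sq_to_K, ← Complex.ofReal_pow]

theorem continuous_norm_sq (u : H) :
    Continuous fun t : ℝ => ‖L.W.toFun t.toNNReal u‖ ^ 2 :=
  (L.W.continuous_real u).norm.pow 2

theorem integral_rate_one (hL : ∀ u v : L.G.domain, L.form 1 u v = 0) (u : L.G.domain)
    {a b : ℝ} (ha : 0 ≤ a) (hab : a ≤ b) : ∫ s in a..b, L.rate s u 1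
      = ‖L.W.toFun a.toNNReal (u : H)‖ ^ 2 - ‖L.W.toFun b.toNNReal (u : H)‖ ^ 2 := by
  have hc := continuous_rate hL zero_le_one le_rfl u
  have h := intervalIntegral.integral_eq_sub_of_hasDeriv_right_of_le hab
    (L.continuous_norm_sq (u : H)).continuousOn
    (fun x hx => hasDerivWithinAt_norm_sq hL u (ha.trans hx.1.le))
    (hc.neg.intervalIntegrable a b)
  rw [intervalIntegral.integral_neg] at h
  linarith

theorem integrableOn_exp {lam : ℝ} (hlam : 0 < lam) (a : ℝ) :
    IntegrableOn (fun t => Real.exp (-(lam * t))) (Set.Ioi a) := by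
  simpa using exp_neg_integrableOn_Ioi a hlam

theorem integral_exp {lam : ℝ} (hlam : 0 < lam) (a : ℝ) :
    ∫ t in Set.Ioi a, Real.exp (-(lam * t)) = Real.exp (-(lam * a)) / lam := by
  have := integral_exp_mul_Ioi (neg_lt_zero.2 hlam) a
  simp only [neg_mul] at this
  rw [this, neg_div_neg_eq]

theorem integrableOn_exp_mul {lam : ℝ} (hlam : 0 < lam) {a C : ℝ} {f : ℝ → ℝ}
    (hf : AEStronglyMeasurable f (volume.restrict (Set.Ioi a))) (hC : ∀ t, ‖f t‖ ≤ C) :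
    IntegrableOn (fun t => Real.exp (-(lam * t)) * f t) (Set.Ioi a) :=
  (integrableOn_exp hlam a).mul_bdd hf (Eventually.of_forall hC)

theorem integral_exp_rate_one (hL : ∀ u v : L.G.domain, L.form 1 u v = 0) (u : L.G.domain)
    {lam : ℝ} (hlam : 0 < lam) :
    IntegrableOn (fun s => Real.exp (-(lam * s)) * L.rate s u 1) (Set.Ioi 0) ∧
    ∫ s in Set.Ioi (0 : ℝ), Real.exp (-(lam * s)) * L.rate s u 1 = ‖(u : H)‖ ^ 2
      - lam * ∫ s in Set.Ioi (0 : ℝ), Real.exp (-(lam * s)) * ‖L.W.toFun s.toNNReal (u : H)‖ ^ 2 := by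
  have hc := continuous_rate hL zero_le_one le_rfl u
  have hn := L.continuous_norm_sq (u : H)
  have hnb : ∀ s : ℝ, ‖L.W.toFun s.toNNReal (u : H)‖ ^ 2 ≤ ‖(u : H)‖ ^ 2 := fun s => by
    have := L.W.norm_apply_le s.toNNReal (u : H)
    gcongr
  have hi1 : IntegrableOn (fun s => Real.exp (-(lam * s)) * L.rate s u 1) (Set.Ioi 0) :=
    integrableOn_exp_mul hlam hc.aestronglyMeasurable fun s => by
      rw [Real.norm_of_nonneg (L.rate_nonneg s u zero_le_one)]
      exact rate_le hL le_rfl s u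
  have hi2 : IntegrableOn (fun s => Real.exp (-(lam * s)) *
      ‖L.W.toFun s.toNNReal (u : H)‖ ^ 2) (Set.Ioi 0) :=
    integrableOn_exp_mul hlam hn.aestronglyMeasurable fun s => by
      rw [Real.norm_of_nonneg (by positivity)]
      exact hnb s
  refine ⟨hi1, ?_⟩
  have he : Continuous fun s : ℝ => Real.exp (-(lam * s)) := by fun_prop
  -- The integrand is minus the right derivative of `exp(-λs) ‖W_s u‖²`; the boundary term at `T`
  -- vanishes as `T → ∞`.
  have hT : ∀ T : ℝ, 0 ≤ T → ∫ s in (0 : ℝ)..T, (Real.exp (-(lam * s)) * L.rate s u 1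
      + lam * (Real.exp (-(lam * s)) * ‖L.W.toFun s.toNNReal (u : H)‖ ^ 2))
      = ‖(u : H)‖ ^ 2 - Real.exp (-(lam * T)) * ‖L.W.toFun T.toNNReal (u : H)‖ ^ 2 := by
    intro T hT
    have hder : ∀ x ∈ Set.Ioo (0 : ℝ) T, HasDerivWithinAt
        (fun s : ℝ => Real.exp (-(lam * s)) * ‖L.W.toFun s.toNNReal (u : H)‖ ^ 2)
        (-(Real.exp (-(lam * x)) * L.rate x u 1
          + lam * (Real.exp (-(lam * x)) * ‖L.W.toFun x.toNNReal (u : H)‖ ^ 2))) (Set.Ioi x) x := by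
      intro x hx
      have h1 : HasDerivAt (fun s : ℝ => Real.exp (-(lam * s)))
          (Real.exp (-(lam * x)) * (-(lam * 1))) x :=
        ((hasDerivAt_id x).const_mul lam).neg.exp
      have h2 := h1.hasDerivWithinAt.mul (hasDerivWithinAt_norm_sq hL u hx.1.le)
      refine h2.congr_deriv ?_
      ring
    have h := intervalIntegral.integral_eq_sub_of_hasDeriv_right_of_le hT
      (f := fun s : ℝ => Real.exp (-(lam * s)) * ‖L.W.toFun s.toNNReal (u : H)‖ ^ 2)
      (he.mul hn).continuousOn hder (((he.mul hc).add ((he.mul hn).const_mul lam)).neg.intervalIntegrable _ _)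
    rw [intervalIntegral.integral_neg] at h
    simp only [mul_zero, neg_zero, Real.exp_zero, one_mul, Real.toNNReal_zero, L.W.map_zero,
      one_apply_eq_self] at h
    linarith
  have hlim := intervalIntegral_tendsto_integral_Ioi 0 (hi1.add (hi2.const_mul lam)) tendsto_id
  have hexp : Tendsto (fun T : ℝ => Real.exp (-(lam * T))) atTop (𝓝 0) :=
    Real.tendsto_exp_neg_atTop_nhds_zero.comp (tendsto_id.const_mul_atTop hlam)
  have h0 : Tendsto (fun T : ℝ => Real.exp (-(lam * T)) *
      ‖L.W.toFun T.toNNReal (u : H)‖ ^ 2) atTop (𝓝 0) := by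
    refine squeeze_zero (fun T => by positivity)
      (fun T => mul_le_mul_of_nonneg_left (hnb T) (Real.exp_pos _).le) ?_
    simpa using hexp.mul_const (‖(u : H)‖ ^ 2)
  have hlim2 := tendsto_nhds_unique hlim ((h0.const_sub (‖(u : H)‖ ^ 2)).congr' (by
    filter_upwards [eventually_ge_atTop 0] with T h
    exact (hT T h).symm))
  rw [integral_add' hi1 (hi2.const_mul lam), integral_const_mul] at hlim2
  linarith

end FormalGenerator

/-- A decreasing family of operators with values in `[0, 1]`. -/
structure IsDecay (E : ℝ≥0 → H →L[ℂ] H) : Prop where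
  antitone : Antitone E
  nonneg : ∀ t, 0 ≤ E t
  le_one : ∀ t, E t ≤ 1

theorem op_le_of_dense_re {ι : Type*} {e : ι → H} (he : DenseRange e)
    {S T : H →L[ℂ] H} (hS : 0 ≤ S) (hT : 0 ≤ T)
    (h : ∀ u, (⟪e u, S (e u)⟫_ℂ).re ≤ (⟪e u, T (e u)⟫_ℂ).re) : S ≤ T := by
  rw [← sub_nonneg]
  refine op_nonneg_of_dense he fun u => ?_
  rw [sub_apply, inner_sub_right, inner_eq_re hS, inner_eq_re hT, ← Complex.ofReal_sub]
  exact Complex.zero_le_real.2 (sub_nonneg.2 (h u))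

theorem op_eq_of_dense_re {ι : Type*} {e : ι → H} (he : DenseRange e)
    {S T : H →L[ℂ] H} (hS : 0 ≤ S) (hT : 0 ≤ T)
    (h : ∀ u, (⟪e u, S (e u)⟫_ℂ).re = (⟪e u, T (e u)⟫_ℂ).re) : S = T :=
  le_antisymm (op_le_of_dense_re (e := e) he hS hT fun u => (h u).le)
    (op_le_of_dense_re (e := e) he hT hS fun u => (h u).ge)

/-! ### The iteration on decreasing families and its limit. -/

namespace FormalGenerator

variable {L : FormalGenerator H}

/-- Joint measurability of a Carathéodory function: continuous in the orbit time, monotone and hence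
measurable in the time of `E`. -/
theorem measurable_rate (hL : ∀ u v : L.G.domain, L.form 1 u v = 0) {E : ℝ≥0 → H →L[ℂ] H}
    (hE : IsDecay E) (u : L.G.domain) :
    Measurable fun p : ℝ × ℝ => L.rate p.1 u (E p.2.toNNReal) := by
  refine measurable_uncurry_of_continuous_of_measurable
    (u := fun s τ : ℝ => L.rate s u (E τ.toNNReal)) (fun τ => ?_) fun s => ?_
  · exact continuous_rate hL (hE.nonneg _) (hE.le_one _) u
  · have : Antitone fun τ : ℝ => L.rate s u (E τ.toNNReal) := fun a b h =>
      L.rate_mono s u (hE.antitone (Real.toNNReal_mono h))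
    exact this.measurable

theorem norm_rate_le (hL : ∀ u v : L.G.domain, L.form 1 u v = 0) {x : H →L[ℂ] H} (h0 : 0 ≤ x)
    (h1 : x ≤ 1) (s : ℝ) (u : L.G.domain) : ‖L.rate s u x‖ ≤ 2 * ‖L.G u‖ * ‖(u : H)‖ := by
  rw [Real.norm_of_nonneg (L.rate_nonneg s u h0)]
  exact rate_le hL h1 s u

theorem intervalIntegrable_rate (hL : ∀ u v : L.G.domain, L.form 1 u v = 0)
    {E : ℝ≥0 → H →L[ℂ] H} (hE : IsDecay E) (u : L.G.domain) {f g : ℝ → ℝ} (hf : Measurable f)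
    (hg : Measurable g) (a b : ℝ) :
    IntervalIntegrable (fun τ => L.rate (f τ) u (E (g τ).toNNReal)) volume a b := by
  rw [intervalIntegrable_iff]
  refine Measure.integrableOn_of_bounded (M := 2 * ‖L.G u‖ * ‖(u : H)‖)
    measure_Ioc_lt_top.ne ?_ (Eventually.of_forall fun τ => ?_)
  · exact ((measurable_rate hL hE u).comp (hf.prodMk hg)).aestronglyMeasurable
  · exact norm_rate_le hL (hE.nonneg _) (hE.le_one _) _ u

/-- `E'` is obtained from `E` by one step of the iteration defining the minimal semigroup. -/
def IsNext (L : FormalGenerator H) (E E' : ℝ≥0 → H →L[ℂ] H) : Prop :=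
  ∀ (t : ℝ≥0) (u : L.G.domain), (⟪(u : H), E' t u⟫_ℂ).re = ‖L.W.toFun t (u : H)‖ ^ 2
    + ∫ τ in (0 : ℝ)..t, L.rate (t - τ) u (E τ.toNNReal)

/-- Replacing `E` by `1` leaves the exact loss of `‖W_s u‖²` over `[0, t]`. This keeps the next
iterate below `1`. -/
theorem integral_rate_sub_le (hL : ∀ u v : L.G.domain, L.form 1 u v = 0)
    {E : ℝ≥0 → H →L[ℂ] H} (hE : IsDecay E) (u : L.G.domain) (t : ℝ≥0) :
    ∫ τ in (0 : ℝ)..t, L.rate (t - τ) u (E τ.toNNReal)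
      ≤ ‖(u : H)‖ ^ 2 - ‖L.W.toFun t (u : H)‖ ^ 2 := by
  have h1 := intervalIntegral.integral_mono_on (NNReal.coe_nonneg t)
    (intervalIntegrable_rate hL hE u (f := fun τ => t - τ) (by fun_prop) measurable_id 0 t)
    (((continuous_rate hL zero_le_one le_rfl u).comp
      (continuous_const.sub continuous_id)).intervalIntegrable 0 (t : ℝ))
    (fun τ _ => L.rate_mono (t - τ) u (hE.le_one τ.toNNReal))
  refine h1.trans (le_of_eq ?_)
  have h2 := intervalIntegral.integral_comp_sub_left (fun s => L.rate s u 1) (t : ℝ)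
    (a := 0) (b := t)
  have h3 := integral_rate_one hL u le_rfl (NNReal.coe_nonneg t)
  simp only [sub_self, sub_zero] at h2
  simp only [Real.toNNReal_zero, L.W.map_zero, one_apply_eq_self, Real.toNNReal_coe] at h3
  exact h2.trans h3

theorem exists_next (hL : ∀ u v : L.G.domain, L.form 1 u v = 0)
    {E : ℝ≥0 → H →L[ℂ] H} (hE : IsDecay E) (t : ℝ≥0) : ∃ T : H →L[ℂ] H, 0 ≤ T ∧ T ≤ 1 ∧
      (∀ u v : L.G.domain, ⟪(u : H), T v⟫_ℂ =
        ⟪(u : H), (star (L.W.toFun t) * 1 * L.W.toFun t) (v : H)⟫_ℂ +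
        ∫ τ in (0 : ℝ)..t, L.φ (E τ.toNNReal)
          (L.orbit ((t : ℝ) - τ).toNNReal u) (L.orbit ((t : ℝ) - τ).toNNReal v)) ∧
      ∀ u : L.G.domain, (⟪(u : H), T u⟫_ℂ).re = ‖L.W.toFun t (u : H)‖ ^ 2
        + ∫ τ in (0 : ℝ)..t, L.rate (t - τ) u (E τ.toNNReal) := by
  let μ : Measure ℝ := volume.restrict (Set.Ioc 0 (t : ℝ))
  let B : ℝ → SesqForm L.G.domain := fun τ => L.pull (E τ.toNNReal) (t - τ)
  have hBr : ∀ τ u, B τ u u = (L.rate (t - τ) u (E τ.toNNReal) : ℂ) := fun τ u =>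
    L.pull_self (hE.nonneg _) _ u
  have hint : ∀ u, Integrable (fun τ => B τ u u) μ := fun u => by
    simp only [hBr]
    exact ((intervalIntegrable_rate hL hE u (f := fun τ => t - τ) (by fun_prop)
      measurable_id 0 t).1).ofReal
  let F : SesqForm L.G.domain := (opForm (star (L.W.toFun t) * 1 * L.W.toFun t)).domRestrict₁₂
    L.G.domain L.G.domain + formIntegral μ B hint
  have hF : ∀ u v, F u v = ⟪(u : H), (star (L.W.toFun t) * 1 * L.W.toFun t) (v : H)⟫_ℂ +
        ∫ τ in (0 : ℝ)..t, L.φ (E τ.toNNReal)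
          (L.orbit ((t : ℝ) - τ).toNNReal u) (L.orbit ((t : ℝ) - τ).toNNReal v) := fun u v => by
    rw [intervalIntegral.integral_of_le (NNReal.coe_nonneg t)]
    rfl
  have hFd : ∀ u, F u u = ((‖L.W.toFun t (u : H)‖ ^ 2
        + ∫ τ in (0 : ℝ)..t, L.rate (t - τ) u (E τ.toNNReal) : ℝ) : ℂ) := fun u => by
    have h1 : ⟪(u : H), (star (L.W.toFun t) * 1 * L.W.toFun t) (u : H)⟫_ℂ
        = ((‖L.W.toFun t (u : H)‖ ^ 2 : ℝ) : ℂ) := by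
      rw [mul_one, ContinuousLinearMap.star_eq_adjoint]
      change ⟪(u : H), ContinuousLinearMap.adjoint (L.W.toFun t) (L.W.toFun t (u : H))⟫_ℂ = _
      rw [ContinuousLinearMap.adjoint_inner_right, inner_self_eq_norm_sq_to_K]
      simp
    rw [hF, h1, Complex.ofReal_add, ← intervalIntegral.integral_ofReal]
    congr 1
    exact intervalIntegral.integral_congr fun τ _ => hBr τ u
  have hpos : ∀ u, 0 ≤ F u u := fun u => by
    rw [hFd]
    refine Complex.zero_le_real.2 (add_nonneg (sq_nonneg _) ?_)
    exact intervalIntegral.integral_nonneg (NNReal.coe_nonneg t) fun τ _ =>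
      L.rate_nonneg _ u (hE.nonneg _)
  obtain ⟨T, hT0, hT1, hT⟩ := exists_operator_of_form L.dense_domain (B := F) hpos fun u => by
    rw [hFd, Complex.ofReal_re]
    have := integral_rate_sub_le hL hE u t
    simp only [Submodule.subtype_apply]
    linarith
  refine ⟨T, hT0, hT1, fun u v => (hT u v).trans (hF u v), fun u => ?_⟩
  have h := hT u u
  rw [hFd] at h
  exact congrArg Complex.re h

/-- With `s = t - τ` the integrand becomes the rate at `s` of `E (t - s)`, which decreases in `t` on
the old interval. The extra piece over `[t, t']` is at most `‖W_t u‖² - ‖W_t' u‖²`, exactly what the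
free term loses. -/
theorem IsNext.antitone (hL : ∀ u v : L.G.domain, L.form 1 u v = 0)
    {E E' : ℝ≥0 → H →L[ℂ] H} (hE : IsDecay E) (h : L.IsNext E E') (h0 : ∀ t, 0 ≤ E' t) :
    Antitone E' := by
  intro t t' htt
  refine op_le_of_dense_re (e := L.G.domain.subtype) L.dense_domain (h0 t') (h0 t) fun u => ?_
  simp only [Submodule.subtype_apply]
  rw [h t' u, h t u]
  have hsub : ∀ r : ℝ≥0, ∫ τ in (0 : ℝ)..r, L.rate (r - τ) u (E τ.toNNReal)
      = ∫ s in (0 : ℝ)..r, L.rate s u (E (r - s).toNNReal) := fun r => by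
    have := intervalIntegral.integral_comp_sub_left
      (fun s => L.rate s u (E (r - s).toNNReal)) (r : ℝ) (a := 0) (b := r)
    simpa using this
  have hint : ∀ (r : ℝ≥0) (a b : ℝ),
      IntervalIntegrable (fun s => L.rate s u (E (r - s).toNNReal)) volume a b := fun r a b =>
    intervalIntegrable_rate hL hE u measurable_id (g := fun s => (r : ℝ) - s) (by fun_prop) a b
  have htt' : (t : ℝ) ≤ t' := NNReal.coe_le_coe.2 htt
  rw [hsub, hsub, ← intervalIntegral.integral_add_adjacent_intervals (hint t' 0 t) (hint t' t t')]
  have h1 : ∫ s in (0 : ℝ)..t, L.rate s u (E (t' - s).toNNReal)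
      ≤ ∫ s in (0 : ℝ)..t, L.rate s u (E (t - s).toNNReal) :=
    intervalIntegral.integral_mono_on (NNReal.coe_nonneg t) (hint t' 0 t) (hint t 0 t) fun s _ =>
      L.rate_mono s u (hE.antitone (Real.toNNReal_mono (by linarith)))
  have h2 : ∫ s in (t : ℝ)..t', L.rate s u (E (t' - s).toNNReal)
      ≤ ∫ s in (t : ℝ)..t', L.rate s u 1 :=
    intervalIntegral.integral_mono_on htt' (hint t' t t')
      ((continuous_rate hL zero_le_one le_rfl u).intervalIntegrable _ _) fun s _ =>
      L.rate_mono s u (hE.le_one _)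
  rw [integral_rate_one hL u (NNReal.coe_nonneg t) htt', Real.toNNReal_coe,
    Real.toNNReal_coe] at h2
  linarith

theorem IsNext.mono (hL : ∀ u v : L.G.domain, L.form 1 u v = 0)
    {E E' F F' : ℝ≥0 → H →L[ℂ] H} (hE : IsDecay E) (hF : IsDecay F) (hEF : ∀ t, E t ≤ F t)
    (hE' : L.IsNext E E') (hF' : L.IsNext F F') (h0 : ∀ t, 0 ≤ E' t) (h0' : ∀ t, 0 ≤ F' t)
    (t : ℝ≥0) : E' t ≤ F' t := by
  refine op_le_of_dense_re (e := L.G.domain.subtype) L.dense_domain (h0 t) (h0' t) fun u => ?_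
  simp only [Submodule.subtype_apply]
  rw [hE' t u, hF' t u]
  gcongr
  exact intervalIntegral.integral_mono_on (NNReal.coe_nonneg t)
    (intervalIntegrable_rate hL hE u (f := fun τ => t - τ) (by fun_prop) measurable_id 0 t)
    (intervalIntegrable_rate hL hF u (f := fun τ => t - τ) (by fun_prop) measurable_id 0 t)
    fun τ _ => L.rate_mono _ u (hEF _)

theorem iter_succ_spec (hL : ∀ u v : L.G.domain, L.form 1 u v = 0) (n : ℕ)
    (hn : IsDecay fun t => L.iter n t 1) :
    IsDecay (fun t => L.iter (n + 1) t 1) ∧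
      L.IsNext (fun t => L.iter n t 1) (fun t => L.iter (n + 1) t 1) := by
  have h : ∀ t, 0 ≤ L.iter (n + 1) t 1 ∧ L.iter (n + 1) t 1 ≤ 1 ∧
      ∀ u : L.G.domain, (⟪(u : H), L.iter (n + 1) t 1 u⟫_ℂ).re = ‖L.W.toFun t (u : H)‖ ^ 2
        + ∫ τ in (0 : ℝ)..t, L.rate (t - τ) u (L.iter n τ.toNNReal 1) := fun t => by
    obtain ⟨T, hT0, hT1, hT, hTd⟩ := exists_next hL hn t
    have : L.iter (n + 1) t 1 = T := by
      rw [iter]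
      exact opOfForm_eq (e := L.G.domain.subtype) L.dense_domain hT
    rw [this]
    exact ⟨hT0, hT1, hTd⟩
  have hnext : L.IsNext (fun t => L.iter n t 1) (fun t => L.iter (n + 1) t 1) :=
    fun t u => (h t).2.2 u
  exact ⟨⟨hnext.antitone hL hn fun t => (h t).1, fun t => (h t).1, fun t => (h t).2.1⟩, hnext⟩

theorem iter_isDecay (hL : ∀ u v : L.G.domain, L.form 1 u v = 0) (n : ℕ) :
    IsDecay fun t => L.iter n t 1 := by
  induction n with
  | zero => exact ⟨fun _ _ _ => le_rfl, fun _ => le_rfl, fun _ => zero_le_one⟩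
  | succ n ih => exact (iter_succ_spec hL n ih).1

theorem iter_isNext (hL : ∀ u v : L.G.domain, L.form 1 u v = 0) (n : ℕ) :
    L.IsNext (fun t => L.iter n t 1) (fun t => L.iter (n + 1) t 1) :=
  (iter_succ_spec hL n (iter_isDecay hL n)).2

theorem iter_monotone (hL : ∀ u v : L.G.domain, L.form 1 u v = 0) (t : ℝ≥0) :
    Monotone fun n => L.iter n t 1 := by
  refine monotone_nat_of_le_succ fun n => ?_
  induction n generalizing t with
  | zero => exact (iter_isDecay hL 1).nonneg t
  | succ n ih =>
    exact IsNext.mono hL (iter_isDecay hL n) (iter_isDecay hL (n + 1)) ih (iter_isNext hL n)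
      (iter_isNext hL (n + 1)) (iter_isDecay hL (n + 1)).nonneg (iter_isDecay hL (n + 2)).nonneg t

/-- The complements `1 - P⁽ⁿ⁾_t(I)` decrease within `[0, 1]`, so the weak limit in the definition
exists and is in fact strong. -/
theorem Pmin_spec (hL : ∀ u v : L.G.domain, L.form 1 u v = 0) (t : ℝ≥0) :
    0 ≤ L.Pmin t 1 ∧ L.Pmin t 1 ≤ 1 ∧ TendstoStrong (fun n => L.iter n t 1) (L.Pmin t 1) := by
  obtain ⟨S, hS0, hS1, hS⟩ := exists_strong_limit (A := fun n => 1 - L.iter n t 1)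
    (fun m n h => sub_le_sub_left (iter_monotone hL t h) 1)
    (fun n => sub_nonneg.2 ((iter_isDecay hL n).le_one t))
    (fun n => sub_le_self _ ((iter_isDecay hL n).nonneg t))
  have hlim : TendstoStrong (fun n => L.iter n t 1) (1 - S) := fun u => by
    have := (hS u).const_sub u
    simpa using this
  have : L.Pmin t 1 = 1 - S := by
    refine opOfForm_eq (e := LinearMap.id) denseRange_id fun u v => ?_
    exact (tendsto_const_nhds.inner (hlim v)).limUnder_eq.symm
  rw [this]
  exact ⟨sub_nonneg.2 hS1, sub_le_self _ hS0, hlim⟩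

theorem Pmin_isDecay (hL : ∀ u v : L.G.domain, L.form 1 u v = 0) :
    IsDecay fun t => L.Pmin t 1 := by
  refine ⟨fun s t h => op_le_iff.2 fun u => ?_, fun t => (Pmin_spec hL t).1,
    fun t => (Pmin_spec hL t).2.1⟩
  exact le_of_tendsto_of_tendsto' (tendsto_const_nhds.inner ((Pmin_spec hL t).2.2 u))
    (tendsto_const_nhds.inner ((Pmin_spec hL s).2.2 u))
    fun n => op_le_iff.1 ((iter_isDecay hL n).antitone h) u

end FormalGenerator

/-! ### Riemann sums for Laplace integrals of decreasing functions and families. -/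

section Riemann

variable {lam : ℝ}

theorem continuous_exp_neg_mul (lam : ℝ) : Continuous fun t : ℝ => Real.exp (-(lam * t)) := by
  fun_prop

theorem intervalIntegral_exp_nonneg (lam : ℝ) {a b : ℝ} (hab : a ≤ b) :
    0 ≤ ∫ t in a..b, Real.exp (-(lam * t)) :=
  intervalIntegral.integral_nonneg hab fun _ _ => (Real.exp_pos _).le

theorem intervalIntegral_exp_le (hlam : 0 < lam) {a b : ℝ} (ha : 0 ≤ a) (hab : a ≤ b) :
    ∫ t in a..b, Real.exp (-(lam * t)) ≤ b - a := by
  have h := intervalIntegral.integral_mono_on hab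
    ((continuous_exp_neg_mul lam).intervalIntegrable a b) (g := fun _ => (1 : ℝ))
    (intervalIntegrable_const (μ := volume))
    fun t ht => Real.exp_le_one_iff.2 (by nlinarith [mul_nonneg hlam.le (ha.trans ht.1)])
  simpa using h

theorem antitone_intervalIntegral_bounds {f : ℝ → ℝ} (hf : Antitone f) {a b : ℝ} (hab : a ≤ b) :
    (∫ t in a..b, Real.exp (-(lam * t))) * f b ≤ ∫ t in a..b, Real.exp (-(lam * t)) * f t ∧
    ∫ t in a..b, Real.exp (-(lam * t)) * f t ≤ (∫ t in a..b, Real.exp (-(lam * t))) * f a := by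
  have hc := continuous_exp_neg_mul lam
  have hi : IntervalIntegrable (fun t => Real.exp (-(lam * t)) * f t) volume a b :=
    hf.intervalIntegrable.continuousOn_mul hc.continuousOn
  have hi' : ∀ c : ℝ, IntervalIntegrable (fun t => Real.exp (-(lam * t)) * c) volume a b :=
    fun c => (hc.mul continuous_const).intervalIntegrable _ _
  simp only [← intervalIntegral.integral_mul_const]
  constructor
  · exact intervalIntegral.integral_mono_on hab (hi' _) hi fun t ht =>
      mul_le_mul_of_nonneg_left (hf ht.2) (Real.exp_pos _).le
  · exact intervalIntegral.integral_mono_on hab hi (hi' _) fun t ht =>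
      mul_le_mul_of_nonneg_left (hf ht.1) (Real.exp_pos _).le

/-- The weight of the `k`-th cell of the grid of mesh `h` in the Laplace integral. -/
def cellWeight (lam h : ℝ) (k : ℕ) : ℝ :=
  ∫ t in (k * h)..((k + 1 : ℕ) * h), Real.exp (-(lam * t))

theorem antitone_laplace_bounds (hlam : 0 < lam) {f : ℝ → ℝ} (hf : Antitone f) {M : ℝ}
    (h0 : ∀ t, 0 ≤ f t) (hM : ∀ t, f t ≤ M) {h : ℝ} (hh : 0 ≤ h) (N : ℕ) :
    ∑ k ∈ Finset.range N, cellWeight lam h k * f ((k + 1 : ℕ) * h)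
      ≤ ∫ t in Set.Ioi (0 : ℝ), Real.exp (-(lam * t)) * f t ∧
    ∫ t in Set.Ioi (0 : ℝ), Real.exp (-(lam * t)) * f t
      ≤ ∑ k ∈ Finset.range N, cellWeight lam h k * f (k * h)
        + Real.exp (-(lam * (N * h))) / lam * M := by
  have hint : ∀ a : ℝ, IntegrableOn (fun t => Real.exp (-(lam * t)) * f t) (Set.Ioi a) := fun a =>
    FormalGenerator.integrableOn_exp_mul hlam (C := M) hf.measurable.aestronglyMeasurable
      fun t => by rw [Real.norm_of_nonneg (h0 t)]; exact hM t
  have hNh : 0 ≤ (N : ℝ) * h := by positivity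
  have hsplit := intervalIntegral.integral_interval_add_Ioi (hint 0) (hint (N * h))
  have hsum := intervalIntegral.sum_integral_adjacent_intervals (a := fun k : ℕ => (k : ℝ) * h)
    (n := N) (μ := volume) (f := fun t => Real.exp (-(lam * t)) * f t) fun k _ =>
    hf.intervalIntegrable.continuousOn_mul (continuous_exp_neg_mul lam).continuousOn
  have hcell : ∀ k : ℕ, (k : ℝ) * h ≤ ((k + 1 : ℕ) : ℝ) * h := fun k => by
    push_cast; nlinarith
  simp only [Nat.cast_zero, zero_mul] at hsum
  rw [← hsplit, ← hsum]
  have htail0 : 0 ≤ ∫ t in Set.Ioi ((N : ℝ) * h), Real.exp (-(lam * t)) * f t :=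
    setIntegral_nonneg measurableSet_Ioi fun t _ => mul_nonneg (Real.exp_pos _).le (h0 t)
  have htail1 : ∫ t in Set.Ioi ((N : ℝ) * h), Real.exp (-(lam * t)) * f t
      ≤ Real.exp (-(lam * (N * h))) / lam * M := by
    rw [← FormalGenerator.integral_exp hlam, ← integral_mul_const]
    exact integral_mono (hint _) ((FormalGenerator.integrableOn_exp hlam _).mul_const M)
      fun t => mul_le_mul_of_nonneg_left (hM t) (Real.exp_pos _).le
  constructor
  · refine (Finset.sum_le_sum fun k _ => ?_).trans (le_add_of_nonneg_right htail0)
    exact (antitone_intervalIntegral_bounds hf (hcell k)).1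
  · refine add_le_add (Finset.sum_le_sum fun k _ => ?_) htail1
    exact (antitone_intervalIntegral_bounds hf (hcell k)).2

/-- Each cell weight is at most the mesh `h`, so the gap is dominated by a telescoping sum. -/
theorem riemann_gap_le (hlam : 0 < lam) {f : ℝ → ℝ} (hf : Antitone f) (h0 : ∀ t, 0 ≤ f t)
    {h : ℝ} (hh : 0 ≤ h) (N : ℕ) :
    ∑ k ∈ Finset.range N, cellWeight lam h k * f (k * h)
      - ∑ k ∈ Finset.range N, cellWeight lam h k * f ((k + 1 : ℕ) * h) ≤ h * f 0 := by
  have hcell : ∀ k : ℕ, (k : ℝ) * h ≤ ((k + 1 : ℕ) : ℝ) * h := fun k => by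
    push_cast; nlinarith
  have h1 : ∀ k : ℕ, cellWeight lam h k * f (k * h) - cellWeight lam h k * f ((k + 1 : ℕ) * h)
      ≤ h * (f (k * h) - f ((k + 1 : ℕ) * h)) := fun k => by
    rw [← mul_sub]
    refine mul_le_mul_of_nonneg_right ?_ (sub_nonneg.2 (hf (hcell k)))
    refine (intervalIntegral_exp_le hlam (by positivity) (hcell k)).trans (le_of_eq ?_)
    push_cast; ring
  rw [← Finset.sum_sub_distrib]
  refine (Finset.sum_le_sum fun k _ => h1 k).trans ?_
  rw [← Finset.mul_sum, Finset.sum_range_sub' (fun k : ℕ => f (k * h))]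
  refine mul_le_mul_of_nonneg_left ?_ hh
  have := h0 (N * h)
  simp only [Nat.cast_zero, zero_mul]
  linarith

end Riemann

/-- The quadratic form of an operator at a vector, as a functional of the operator. -/
def vectorFunctional (u : H) : (H →L[ℂ] H) →ₗ[ℝ] ℝ where
  toFun x := (⟪u, x u⟫_ℂ).re
  map_add' x y := by simp
  map_smul' c x := by
    have h : c • x = (c : ℂ) • x := (Complex.coe_smul c x).symm
    rw [h]
    simp

theorem vectorFunctional_apply (u : H) (x : H →L[ℂ] H) :
    vectorFunctional u x = (⟪u, x u⟫_ℂ).re := rfl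

theorem IsDecay.antitone_comp {E : ℝ≥0 → H →L[ℂ] H} (hE : IsDecay E)
    {ω : (H →L[ℂ] H) →ₗ[ℝ] ℝ} (hω : ∀ x, 0 ≤ x → 0 ≤ ω x) :
    Antitone fun t : ℝ => ω (E t.toNNReal) := fun a b h => by
  have := hω _ (sub_nonneg.2 (hE.antitone (Real.toNNReal_mono h)))
  rw [map_sub] at this
  exact sub_nonneg.1 this

theorem real_smul_nonneg {c : ℝ} (hc : 0 ≤ c) {x : H →L[ℂ] H} (hx : 0 ≤ x) : 0 ≤ c • x := by
  refine op_nonneg_iff.2 fun u => ?_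
  have h := inner_eq_re hx u
  have h2 : c • x = (c : ℂ) • x := (Complex.coe_smul c x).symm
  rw [h2, smul_apply, inner_smul_right, h, ← Complex.ofReal_mul]
  exact Complex.zero_le_real.2 (mul_nonneg hc (re_inner_nonneg hx u))

theorem op_le_of_re {S T : H →L[ℂ] H} (hS : 0 ≤ S) (hT : 0 ≤ T)
    (h : ∀ u, vectorFunctional u S ≤ vectorFunctional u T) : S ≤ T :=
  op_le_of_dense_re (e := id) denseRange_id hS hT h

/-- Positive functionals, normal or not, commute with the weak Laplace integral of a decreasing
family, which is a norm limit of Riemann sums. -/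
theorem laplace_exchange {lam : ℝ} (hlam : 0 < lam) {E : ℝ≥0 → H →L[ℂ] H} (hE : IsDecay E)
    {R : H →L[ℂ] H} (hR0 : 0 ≤ R)
    (hR : ∀ u, vectorFunctional u R
      = ∫ t in Set.Ioi (0 : ℝ), Real.exp (-(lam * t)) * vectorFunctional u (E t.toNNReal))
    {ω : (H →L[ℂ] H) →ₗ[ℝ] ℝ} (hω : ∀ x, 0 ≤ x → 0 ≤ ω x) :
    ω R = ∫ t in Set.Ioi (0 : ℝ), Real.exp (-(lam * t)) * ω (E t.toNNReal) := by
  have hmono : ∀ x y, x ≤ y → ω x ≤ ω y := fun x y h => by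
    have := hω _ (sub_nonneg.2 h)
    rw [map_sub] at this
    exact sub_nonneg.1 this
  have hv : ∀ u : H, ∀ x : H →L[ℂ] H, 0 ≤ x → 0 ≤ vectorFunctional u x := fun u x hx =>
    re_inner_nonneg hx u
  have hbound : ∀ n : ℕ, |ω R - ∫ t in Set.Ioi (0 : ℝ), Real.exp (-(lam * t)) * ω (E t.toNNReal)|
      ≤ ((n : ℝ) + 1)⁻¹ * ω 1 + Real.exp (-(lam * ((n : ℝ) + 1))) / lam * ω 1 := by
    intro n
    set h : ℝ := ((n : ℝ) + 1)⁻¹ with hh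
    have hh0 : 0 ≤ h := by positivity
    -- With mesh `1/(n+1)`, this many cells cover `[0, n+1]`, so mesh and tail errors vanish
    -- together.
    set N : ℕ := (n + 1) ^ 2 with hN
    have hNh : (N : ℝ) * h = n + 1 := by
      rw [hN, hh]; push_cast; field_simp
    set δ : ℝ := Real.exp (-(lam * (N * h))) / lam with hδ
    have hδ0 : 0 ≤ δ := by positivity
    have hw : ∀ k, 0 ≤ cellWeight lam h k := fun k =>
      intervalIntegral_exp_nonneg lam (by push_cast; nlinarith)
    let Lo : H →L[ℂ] H := ∑ k ∈ Finset.range N,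
      cellWeight lam h k • E (((k + 1 : ℕ) : ℝ) * h).toNNReal
    let Up : H →L[ℂ] H := ∑ k ∈ Finset.range N, cellWeight lam h k • E ((k : ℝ) * h).toNNReal
      + δ • (1 : H →L[ℂ] H)
    have hLo0 : 0 ≤ Lo := Finset.sum_nonneg fun k _ => real_smul_nonneg (hw k) (hE.nonneg _)
    have hUp0 : 0 ≤ Up := add_nonneg
      (Finset.sum_nonneg fun k _ => real_smul_nonneg (hw k) (hE.nonneg _))
      (real_smul_nonneg hδ0 zero_le_one)
    have hLoω : ∀ ν : (H →L[ℂ] H) →ₗ[ℝ] ℝ, ν Lo = ∑ k ∈ Finset.range N,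
        cellWeight lam h k * ν (E (((k + 1 : ℕ) : ℝ) * h).toNNReal) := fun ν => by
      simp only [Lo, map_sum, map_smul, smul_eq_mul]
    have hUpω : ∀ ν : (H →L[ℂ] H) →ₗ[ℝ] ℝ, ν Up = ∑ k ∈ Finset.range N,
        cellWeight lam h k * ν (E ((k : ℝ) * h).toNNReal) + δ * ν 1 := fun ν => by
      simp only [Up, map_add, map_sum, map_smul, smul_eq_mul]
    -- Used twice: for vector functionals it gives `Lo ≤ R ≤ Up` as operators; for `ω` it places the
    -- scalar integral between `ω Lo` and `ω Up`.
    have hb : ∀ ν : (H →L[ℂ] H) →ₗ[ℝ] ℝ, (∀ x, 0 ≤ x → 0 ≤ ν x) →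
        ν Lo ≤ ∫ t in Set.Ioi (0 : ℝ), Real.exp (-(lam * t)) * ν (E t.toNNReal) ∧
        ∫ t in Set.Ioi (0 : ℝ), Real.exp (-(lam * t)) * ν (E t.toNNReal) ≤ ν Up := fun ν hν => by
      rw [hLoω, hUpω]
      refine antitone_laplace_bounds hlam (hE.antitone_comp hν) (fun t => hν _ (hE.nonneg _))
        (fun t => ?_) hh0 N
      have := hν _ (sub_nonneg.2 (hE.le_one t.toNNReal))
      rw [map_sub] at this
      exact sub_nonneg.1 this
    have hLoR : Lo ≤ R := op_le_of_re hLo0 hR0 fun u => by rw [hR]; exact (hb _ (hv u)).1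
    have hRUp : R ≤ Up := op_le_of_re hR0 hUp0 fun u => by rw [hR]; exact (hb _ (hv u)).2
    have h1 := hmono _ _ hLoR
    have h2 := hmono _ _ hRUp
    obtain ⟨h3, h4⟩ := hb ω hω
    have hgap : ω Up - ω Lo ≤ h * ω 1 + δ * ω 1 := by
      rw [hLoω, hUpω]
      have h5 := riemann_gap_le hlam (hE.antitone_comp hω) (fun t => hω _ (hE.nonneg _)) hh0 N
      have h6 : h * ω (E (0 : ℝ).toNNReal) ≤ h * ω 1 :=
        mul_le_mul_of_nonneg_left (hmono _ _ (hE.le_one _)) hh0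
      linarith
    have hδ' : δ = Real.exp (-(lam * ((n : ℝ) + 1))) / lam := by rw [hδ, hNh]
    rw [← hδ']
    rw [abs_le]
    constructor <;> linarith
  have hlim : Tendsto (fun n : ℕ => ((n : ℝ) + 1)⁻¹ * ω 1
      + Real.exp (-(lam * ((n : ℝ) + 1))) / lam * ω 1) atTop (𝓝 0) := by
    have hn : Tendsto (fun n : ℕ => (n : ℝ) + 1) atTop atTop :=
      tendsto_atTop_add_const_right _ _ tendsto_natCast_atTop_atTop
    have h1 := (tendsto_inv_atTop_zero.comp hn).mul_const (ω 1)
    have h2 := (((Real.tendsto_exp_neg_atTop_nhds_zero.comp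
      (tendsto_id.const_mul_atTop hlam)).comp hn).div_const lam).mul_const (ω 1)
    simpa using h1.add h2
  have h0 := ge_of_tendsto' hlim hbound
  exact sub_eq_zero.1 (abs_nonpos_iff.1 h0)

/-! ### Normalized Laplace averages. -/

section Average

variable {lam : ℝ}

/-- `X = λ ∫_0^∞ exp (-λ t) E_t dt` as a quadratic form, with `0 ≤ X ≤ 1`. -/
structure IsAverage (lam : ℝ) (E : ℝ≥0 → H →L[ℂ] H) (X : H →L[ℂ] H) : Prop where
  nonneg : 0 ≤ X
  le_one : X ≤ 1
  isLaplaceTransform : IsLaplaceTransform lam E ((lam : ℂ)⁻¹ • X)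

theorem IsDecay.integrableOn (hlam : 0 < lam) {E : ℝ≥0 → H →L[ℂ] H} (hE : IsDecay E)
    {ω : (H →L[ℂ] H) →ₗ[ℝ] ℝ} (hω : ∀ x, 0 ≤ x → 0 ≤ ω x) :
    IntegrableOn (fun t : ℝ => Real.exp (-(lam * t)) * ω (E t.toNNReal)) (Set.Ioi 0) :=
  FormalGenerator.integrableOn_exp_mul hlam (C := ω 1)
    (hE.antitone_comp hω).measurable.aestronglyMeasurable fun t => by
      rw [Real.norm_of_nonneg (hω _ (hE.nonneg _))]
      have := hω _ (sub_nonneg.2 (hE.le_one t.toNNReal))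
      rw [map_sub] at this
      exact sub_nonneg.1 this

theorem vectorFunctional_nonneg (u : H) (x : H →L[ℂ] H) (hx : 0 ≤ x) :
    0 ≤ vectorFunctional u x := re_inner_nonneg hx u

theorem IsDecay.exists_average (hlam : 0 < lam) {E : ℝ≥0 → H →L[ℂ] H} (hE : IsDecay E) :
    ∃ X, IsAverage lam E X := by
  let B : ℝ → H →ₗ⋆[ℂ] H →ₗ[ℂ] ℂ := fun t =>
    (Real.exp (-(lam * t)) : ℂ) • opForm (E t.toNNReal)
  have hB : ∀ t u v, B t u v = (Real.exp (-(lam * t)) : ℂ) * ⟪u, E t.toNNReal v⟫_ℂ :=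
    fun _ _ _ => rfl
  have hBd : ∀ t u, B t u u
      = ((Real.exp (-(lam * t)) * vectorFunctional u (E t.toNNReal) : ℝ) : ℂ) := fun t u => by
    rw [hB, inner_eq_re (hE.nonneg _), ← Complex.ofReal_mul]; rfl
  have hint : ∀ u, Integrable (fun t => B t u u) (volume.restrict (Set.Ioi (0 : ℝ))) := fun u => by
    simp only [hBd]
    exact (hE.integrableOn hlam (vectorFunctional_nonneg u)).ofReal
  let F := (lam : ℂ) • formIntegral _ B hint
  have hFd : ∀ u, F u u = ((lam * ∫ t in Set.Ioi (0 : ℝ),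
      Real.exp (-(lam * t)) * vectorFunctional u (E t.toNNReal) : ℝ) : ℂ) := fun u => by
    change (lam : ℂ) * ∫ t in Set.Ioi (0 : ℝ), B t u u = _
    simp only [hBd]
    rw [integral_complex_ofReal, Complex.ofReal_mul]
  obtain ⟨X, hX0, hX1, hX⟩ := exists_operator_of_form (e := LinearMap.id) denseRange_id (B := F)
    (fun u => by
      rw [hFd]
      refine Complex.zero_le_real.2 (mul_nonneg hlam.le ?_)
      exact setIntegral_nonneg measurableSet_Ioi fun t _ =>
        mul_nonneg (Real.exp_pos _).le (re_inner_nonneg (hE.nonneg _) u))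
    (fun u => by
      rw [hFd, Complex.ofReal_re]
      have h1 : ∫ t in Set.Ioi (0 : ℝ), Real.exp (-(lam * t)) * vectorFunctional u (E t.toNNReal)
          ≤ ∫ t in Set.Ioi (0 : ℝ), Real.exp (-(lam * t)) * ‖u‖ ^ 2 :=
        integral_mono (hE.integrableOn hlam (vectorFunctional_nonneg u))
          ((FormalGenerator.integrableOn_exp hlam 0).mul_const _) fun t =>
          mul_le_mul_of_nonneg_left (re_inner_le_norm_sq (hE.le_one _) u) (Real.exp_pos _).le
      rw [integral_mul_const, FormalGenerator.integral_exp hlam] at h1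
      simp only [mul_zero, neg_zero, Real.exp_zero] at h1
      have h2 := mul_le_mul_of_nonneg_left h1 hlam.le
      rw [← mul_assoc, mul_one_div_cancel hlam.ne', one_mul] at h2
      exact h2)
  refine ⟨X, hX0, hX1, fun u v => ⟨sesq_integrable hint u v, ?_⟩⟩
  have h := hX u v
  have hl : (lam : ℂ) ≠ 0 := Complex.ofReal_ne_zero.2 hlam.ne'
  rw [smul_apply, inner_smul_right]
  rw [LinearMap.id_apply, LinearMap.id_apply] at h
  rw [h]
  change (lam : ℂ)⁻¹ * ((lam : ℂ) * ∫ t in Set.Ioi (0 : ℝ), B t u v) = _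
  rw [inv_mul_cancel_left₀ hl]
  rfl

theorem IsAverage.vectorFunctional_eq (hlam : 0 < lam) {E : ℝ≥0 → H →L[ℂ] H} (hE : IsDecay E)
    {X : H →L[ℂ] H} (hX : IsAverage lam E X) (u : H) : vectorFunctional u X
      = lam * ∫ t in Set.Ioi (0 : ℝ), Real.exp (-(lam * t)) * vectorFunctional u (E t.toNNReal) := by
  have h := (hX.isLaplaceTransform u u).2
  have h1 : ∫ t in Set.Ioi (0 : ℝ), (Real.exp (-(lam * t)) : ℂ) * ⟪u, E t.toNNReal u⟫_ℂ
      = ((∫ t in Set.Ioi (0 : ℝ), Real.exp (-(lam * t)) * vectorFunctional u (E t.toNNReal) : ℝ)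
        : ℂ) := by
    rw [← integral_complex_ofReal]
    refine integral_congr_ae (Eventually.of_forall fun t => ?_)
    simp only
    rw [inner_eq_re (hE.nonneg _), ← Complex.ofReal_mul]
    rfl
  rw [h1, smul_apply, inner_smul_right, inner_eq_re hX.nonneg, ← Complex.ofReal_inv,
    ← Complex.ofReal_mul] at h
  have h2 := Complex.ofReal_injective h
  rw [← h2, mul_inv_cancel_left₀ hlam.ne']
  rfl

theorem IsAverage.exchange (hlam : 0 < lam) {E : ℝ≥0 → H →L[ℂ] H} (hE : IsDecay E)
    {X : H →L[ℂ] H} (hX : IsAverage lam E X) {ω : (H →L[ℂ] H) →ₗ[ℝ] ℝ}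
    (hω : ∀ x, 0 ≤ x → 0 ≤ ω x) :
    ω X = lam * ∫ t in Set.Ioi (0 : ℝ), Real.exp (-(lam * t)) * ω (E t.toNNReal) := by
  have h := laplace_exchange hlam hE (R := lam⁻¹ • X)
    (real_smul_nonneg (inv_nonneg.2 hlam.le) hX.nonneg) (fun u => by
      rw [map_smul, hX.vectorFunctional_eq hlam hE, smul_eq_mul, inv_mul_cancel_left₀ hlam.ne']) hω
  rw [← h, map_smul, smul_eq_mul, mul_inv_cancel_left₀ hlam.ne']

theorem IsAverage.isLaplaceTransform_one_sub (hlam : 0 < lam) {E : ℝ≥0 → H →L[ℂ] H}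
    {X : H →L[ℂ] H} (hX : IsAverage lam E X) :
    IsLaplaceTransform lam (fun t => 1 - E t) ((lam : ℂ)⁻¹ • (1 - X)) := by
  intro u v
  obtain ⟨hi, he⟩ := hX.isLaplaceTransform u v
  have hi1 : IntegrableOn (fun t : ℝ => (Real.exp (-(lam * t)) : ℂ) * ⟪u, v⟫_ℂ) (Set.Ioi 0) :=
    ((FormalGenerator.integrableOn_exp hlam 0).ofReal).mul_const _
  have hfun : (fun t : ℝ => (Real.exp (-(lam * t)) : ℂ)
      * ⟪u, ((1 : H →L[ℂ] H) - E t.toNNReal) v⟫_ℂ)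
      = fun t : ℝ => (Real.exp (-(lam * t)) : ℂ) * ⟪u, v⟫_ℂ
        - (Real.exp (-(lam * t)) : ℂ) * ⟪u, E t.toNNReal v⟫_ℂ := by
    funext t
    rw [sub_apply, inner_sub_right, one_apply_eq_self, mul_sub]
  refine ⟨by rw [hfun]; exact hi1.sub hi, ?_⟩
  rw [hfun, integral_sub hi1 hi, ← he, integral_mul_const, integral_complex_ofReal,
    FormalGenerator.integral_exp hlam]
  simp [mul_sub]

theorem IsLaplaceTransform.unique {F : ℝ≥0 → H →L[ℂ] H} {S T : H →L[ℂ] H}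
    (hS : IsLaplaceTransform lam F S) (hT : IsLaplaceTransform lam F T) : S = T := by
  ext v
  exact ext_inner_left ℂ fun u => (hS u v).2.trans (hT u v).2.symm

theorem IsLaplaceTransform.laplaceTransform_eq {F : ℝ≥0 → H →L[ℂ] H} {T : H →L[ℂ] H}
    (hT : IsLaplaceTransform lam F T) : laplaceTransform lam F = T := by
  have h : ∃ T, IsLaplaceTransform lam F T := ⟨T, hT⟩
  rw [laplaceTransform, dif_pos h]
  exact h.choose_spec.unique hT

end Average

/-- The Laplace transform of a convolution-type integral. -/
theorem integral_laplace_convolution {lam : ℝ} (hlam : 0 < lam) {k : ℝ × ℝ → ℝ} (hk : Measurable k)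
    {C : ℝ} (hC : ∀ p, ‖k p‖ ≤ C) :
    ∫ t in Set.Ioi (0 : ℝ), Real.exp (-(lam * t)) *
        ∫ τ in Set.Ioi (0 : ℝ), Real.exp (-(lam * τ)) * k (t, τ)
      = ∫ s in Set.Ioi (0 : ℝ), Real.exp (-(lam * s)) * ∫ τ in (0 : ℝ)..s, k (s - τ, τ) := by
  let ν : Measure ℝ := volume.restrict (Set.Ioi 0)
  let f : ℝ × ℝ → ℝ := fun p => Real.exp (-(lam * p.1)) * Real.exp (-(lam * p.2)) * k p
  let S : Set (ℝ × ℝ) := Set.Ioi 0 ×ˢ Set.Ioi 0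
  have hS : MeasurableSet S := measurableSet_Ioi.prod measurableSet_Ioi
  have hν : ν.prod ν = (volume.prod volume).restrict S := Measure.prod_restrict _ _
  have he := FormalGenerator.integrableOn_exp hlam 0
  have hf : Integrable f (ν.prod ν) :=
    (Integrable.mul_prod he he).mul_bdd hk.aestronglyMeasurable (Eventually.of_forall hC)
  let g : ℝ × ℝ → ℝ := S.indicator f
  have hg : Integrable g (volume.prod volume) := by
    rw [integrable_indicator_iff hS, IntegrableOn, ← hν]
    exact hf
  have hg' : Integrable (fun p : ℝ × ℝ => g (p.1 - p.2, p.2)) (volume.prod volume) :=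
    (measurePreserving_sub_prod (volume : Measure ℝ)
      (volume : Measure ℝ)).integrable_comp_of_integrable hg
  have h1 : ∫ t in Set.Ioi (0 : ℝ), Real.exp (-(lam * t)) *
        ∫ τ in Set.Ioi (0 : ℝ), Real.exp (-(lam * τ)) * k (t, τ) = ∫ p, g p ∂(volume.prod volume) := by
    rw [integral_indicator hS, ← hν, integral_prod _ hf]
    refine integral_congr_ae (Eventually.of_forall fun t => ?_)
    simp only [f, mul_assoc]
    rw [integral_const_mul]
  -- The shear `(s, τ) ↦ (s - τ, τ)` preserves Lebesgue measure and carries the indicator of the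
  -- quadrant to that of `0 < τ < s`.
  have h2 : ∫ p, g p ∂(volume.prod volume) = ∫ s, ∫ τ, g (s - τ, τ) := by
    rw [integral_prod_symm _ hg, integral_integral_swap (f := fun s τ => g (s - τ, τ)) hg']
    refine integral_congr_ae (Eventually.of_forall fun τ => ?_)
    exact (integral_sub_right_eq_self (fun t => g (t, τ)) τ).symm
  have h3 : ∀ s, ∫ τ, g (s - τ, τ) = (Set.Ioi (0 : ℝ)).indicator
      (fun s => Real.exp (-(lam * s)) * ∫ τ in (0 : ℝ)..s, k (s - τ, τ)) s := fun s => by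
    have h4 : (fun τ => g (s - τ, τ)) = (Set.Ioo 0 s).indicator
        (fun τ => Real.exp (-(lam * s)) * k (s - τ, τ)) := by
      funext τ
      by_cases hτ : τ ∈ Set.Ioo 0 s
      · have hm : (s - τ, τ) ∈ S := ⟨sub_pos.2 hτ.2, hτ.1⟩
        simp only [g, Set.indicator_of_mem hτ, Set.indicator_of_mem hm, f]
        rw [← Real.exp_add]
        congr 2
        ring
      · have hm : (s - τ, τ) ∉ S := fun h => hτ ⟨h.2, sub_pos.1 h.1⟩
        simp only [g, Set.indicator_of_notMem hτ, Set.indicator_of_notMem hm]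
    rw [h4, integral_indicator measurableSet_Ioo, integral_const_mul]
    by_cases hs : s ∈ Set.Ioi (0 : ℝ)
    · rw [Set.indicator_of_mem hs, intervalIntegral.integral_of_le (le_of_lt hs),
        integral_Ioc_eq_integral_Ioo]
    · rw [Set.indicator_of_notMem hs, Set.Ioo_eq_empty (by simpa using hs)]
      simp
  rw [h1, h2]
  simp only [h3]
  exact integral_indicator measurableSet_Ioi

/-! ### The action of `Q_λ` on averages. -/

namespace FormalGenerator

variable {L : FormalGenerator H} {lam : ℝ}

/-- The core identity on the diagonal. The contributions of `λ ∫ exp(-λs) ‖W_s u‖² ds` from the rate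
at `1` and from the recursion for `E'` cancel. -/
theorem integral_rate_one_sub (hL : ∀ u v : L.G.domain, L.form 1 u v = 0) (hlam : 0 < lam)
    {E E' : ℝ≥0 → H →L[ℂ] H} (hE : IsDecay E) (hE' : IsDecay E') (h : L.IsNext E E')
    {X X' : H →L[ℂ] H} (hX : IsAverage lam E X) (hX' : IsAverage lam E' X') (u : L.G.domain) :
    ∫ t in Set.Ioi (0 : ℝ), Real.exp (-(lam * t)) * L.rate t u (1 - X)
      = vectorFunctional (u : H) (1 - X') := by
  have hcont : Continuous fun t => L.rate t u X := continuous_rate hL hX.nonneg hX.le_one u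
  obtain ⟨hi1, he1⟩ := integral_exp_rate_one hL u hlam
  have hiX : IntegrableOn (fun t => Real.exp (-(lam * t)) * L.rate t u X) (Set.Ioi 0) :=
    integrableOn_exp_mul hlam hcont.aestronglyMeasurable fun t =>
      norm_rate_le hL hX.nonneg hX.le_one t u
  have hconv := integral_laplace_convolution hlam (measurable_rate hL hE u)
    fun p => norm_rate_le hL (hE.nonneg _) (hE.le_one _) p.1 u
  have hrX : ∫ t in Set.Ioi (0 : ℝ), Real.exp (-(lam * t)) * L.rate t u X
      = lam * ∫ s in Set.Ioi (0 : ℝ), Real.exp (-(lam * s)) *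
        ∫ τ in (0 : ℝ)..s, L.rate (s - τ) u (E τ.toNNReal) := by
    rw [← hconv, ← integral_const_mul]
    refine integral_congr_ae (Eventually.of_forall fun t => ?_)
    simp only
    rw [hX.exchange hlam hE (ω := L.rate t u) fun x hx => L.rate_nonneg t u hx]
    ring
  have hiE' := hE'.integrableOn hlam (vectorFunctional_nonneg (u : H))
  have hin : IntegrableOn (fun s : ℝ => Real.exp (-(lam * s)) *
      ‖L.W.toFun s.toNNReal (u : H)‖ ^ 2) (Set.Ioi 0) :=
    integrableOn_exp_mul hlam (C := ‖(u : H)‖ ^ 2)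
      (L.continuous_norm_sq (u : H)).aestronglyMeasurable fun s => by
      rw [Real.norm_of_nonneg (by positivity)]
      have := L.W.norm_apply_le s.toNNReal (u : H)
      gcongr
  have hsplit : ∫ s in Set.Ioi (0 : ℝ), Real.exp (-(lam * s)) *
        ∫ τ in (0 : ℝ)..s, L.rate (s - τ) u (E τ.toNNReal)
      = (∫ s in Set.Ioi (0 : ℝ), Real.exp (-(lam * s)) * vectorFunctional (u : H) (E' s.toNNReal))
        - ∫ s in Set.Ioi (0 : ℝ), Real.exp (-(lam * s)) *
          ‖L.W.toFun s.toNNReal (u : H)‖ ^ 2 := by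
    rw [← integral_sub hiE' hin]
    refine setIntegral_congr_fun measurableSet_Ioi fun s hs => ?_
    have h1 := h s.toNNReal u
    rw [Real.coe_toNNReal _ (le_of_lt hs)] at h1
    simp only [vectorFunctional_apply]
    rw [h1]
    ring
  have hfun : ∀ t, Real.exp (-(lam * t)) * L.rate t u (1 - X)
      = Real.exp (-(lam * t)) * L.rate t u 1 - Real.exp (-(lam * t)) * L.rate t u X := fun t => by
    rw [map_sub, mul_sub]
  simp only [hfun]
  rw [integral_sub hi1 hiX, he1, hrX, hsplit, map_sub, hX'.vectorFunctional_eq hlam hE']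
  have h1 : vectorFunctional (u : H) 1 = ‖(u : H)‖ ^ 2 := by
    simp [vectorFunctional_apply, inner_self_eq_norm_sq_to_K, ← Complex.ofReal_pow]
  rw [h1]
  ring

theorem Q_one_sub (hL : ∀ u v : L.G.domain, L.form 1 u v = 0) (hlam : 0 < lam)
    {E E' : ℝ≥0 → H →L[ℂ] H} (hE : IsDecay E) (hE' : IsDecay E') (h : L.IsNext E E')
    {X X' : H →L[ℂ] H} (hX : IsAverage lam E X) (hX' : IsAverage lam E' X') :
    L.Q lam (1 - X) = 1 - X' := by
  have h0 : 0 ≤ 1 - X := sub_nonneg.2 hX.le_one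
  have h1 : 1 - X ≤ 1 := sub_le_self _ hX.nonneg
  have h0' : 0 ≤ 1 - X' := sub_nonneg.2 hX'.le_one
  let B : ℝ → SesqForm L.G.domain := fun t => (Real.exp (-(lam * t)) : ℂ) • L.pull (1 - X) t
  have hBd : ∀ t u, B t u u = ((Real.exp (-(lam * t)) * L.rate t u (1 - X) : ℝ) : ℂ) := fun t u => by
    rw [Complex.ofReal_mul, ← L.pull_self h0]; rfl
  have hint : ∀ u, Integrable (fun t => B t u u) (volume.restrict (Set.Ioi (0 : ℝ))) := fun u => by
    simp only [hBd]
    exact Integrable.ofReal (integrableOn_exp_mul hlam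
      (continuous_rate hL h0 h1 u).aestronglyMeasurable fun t => norm_rate_le hL h0 h1 t u)
  have hform : formIntegral _ B hint
      = (opForm (1 - X')).domRestrict₁₂ L.G.domain L.G.domain := by
    refine sesq_ext_diag fun u => ?_
    rw [formIntegral_apply]
    simp only [hBd]
    rw [integral_complex_ofReal, integral_rate_one_sub hL hlam hE hE' h hX hX' u]
    exact (inner_eq_re h0' _).symm
  refine opOfForm_eq (e := L.G.domain.subtype) L.dense_domain fun u v => ?_
  exact (LinearMap.congr_fun (LinearMap.congr_fun hform u) v).symm

theorem average_mono (hlam : 0 < lam) {E F : ℝ≥0 → H →L[ℂ] H} (hE : IsDecay E) (hF : IsDecay F)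
    (h : ∀ t, E t ≤ F t) {X Y : H →L[ℂ] H} (hX : IsAverage lam E X) (hY : IsAverage lam F Y) :
    X ≤ Y := by
  refine op_le_of_re hX.nonneg hY.nonneg fun u => ?_
  rw [hX.vectorFunctional_eq hlam hE, hY.vectorFunctional_eq hlam hF]
  refine mul_le_mul_of_nonneg_left (integral_mono (hE.integrableOn hlam (vectorFunctional_nonneg u))
    (hF.integrableOn hlam (vectorFunctional_nonneg u)) fun t => ?_) hlam.le
  exact mul_le_mul_of_nonneg_left (re_inner_mono (h _) u) (Real.exp_pos _).le

theorem tendsto_average (hL : ∀ u v : L.G.domain, L.form 1 u v = 0) (hlam : 0 < lam)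
    {X : ℕ → H →L[ℂ] H} (hX : ∀ n, IsAverage lam (fun t => L.iter n t 1) (X n))
    {Y : H →L[ℂ] H} (hY : IsAverage lam (fun t => L.Pmin t 1) Y) (u : H) :
    Tendsto (fun n => vectorFunctional u (X n)) atTop (𝓝 (vectorFunctional u Y)) := by
  simp only [fun n => (hX n).vectorFunctional_eq hlam (iter_isDecay hL n),
    hY.vectorFunctional_eq hlam (Pmin_isDecay hL)]
  refine Tendsto.const_mul _ ?_
  refine tendsto_integral_of_dominated_convergence
    (fun t => Real.exp (-(lam * t)) * ‖u‖ ^ 2)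
    (fun n => ((iter_isDecay hL n).integrableOn hlam (vectorFunctional_nonneg u)).1)
    ((integrableOn_exp hlam 0).mul_const _)
    (fun n => Eventually.of_forall fun t => ?_) (Eventually.of_forall fun t => ?_)
  · rw [norm_mul, Real.norm_of_nonneg (Real.exp_pos _).le,
      Real.norm_of_nonneg (vectorFunctional_nonneg u _ ((iter_isDecay hL n).nonneg _))]
    exact mul_le_mul_of_nonneg_left (re_inner_le_norm_sq ((iter_isDecay hL n).le_one _) u)
      (Real.exp_pos _).le
  · refine Tendsto.const_mul _ ?_
    exact (Complex.continuous_re.tendsto _).comp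
      (tendsto_const_nhds.inner ((Pmin_spec hL t.toNNReal).2.2 u))

/-- A decreasing family whose Laplace average is the identity is constantly the identity. -/
theorem eq_one_of_average_one (hlam : 0 < lam) {E : ℝ≥0 → H →L[ℂ] H} (hE : IsDecay E)
    (h : IsAverage lam E 1) (t : ℝ≥0) : E t = 1 := by
  refine (op_eq_of_dense_re (e := id) denseRange_id zero_le_one (hE.nonneg t) fun u => ?_).symm
  have hv : ∀ s, vectorFunctional u (E s) ≤ vectorFunctional u 1 := fun s =>
    re_inner_mono (hE.le_one s) u
  refine le_antisymm ?_ (hv t)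
  by_contra hlt
  have hlt' : vectorFunctional u (E t) < vectorFunctional u 1 := not_le.1 hlt
  let g : ℝ → ℝ := fun s => Real.exp (-(lam * s)) *
    (vectorFunctional u 1 - vectorFunctional u (E s.toNNReal))
  have hi1 : IntegrableOn (fun s => Real.exp (-(lam * s)) * vectorFunctional u 1) (Set.Ioi 0) :=
    (integrableOn_exp hlam 0).mul_const _
  have hi2 := hE.integrableOn hlam (vectorFunctional_nonneg u)
  have hgfun : g = fun s => Real.exp (-(lam * s)) * vectorFunctional u 1
      - Real.exp (-(lam * s)) * vectorFunctional u (E s.toNNReal) := by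
    funext s; simp only [g, mul_sub]
  have hgi : IntegrableOn g (Set.Ioi 0) := by rw [hgfun]; exact hi1.sub hi2
  have hg0 : ∀ s, 0 ≤ g s := fun s => mul_nonneg (Real.exp_pos _).le (sub_nonneg.2 (hv _))
  have hgint : ∫ s in Set.Ioi (0 : ℝ), g s = 0 := by
    rw [hgfun, integral_sub hi1 hi2, integral_mul_const, integral_exp hlam]
    have h3 := h.vectorFunctional_eq hlam hE u
    simp only [mul_zero, neg_zero, Real.exp_zero]
    rw [div_mul_eq_mul_div, one_mul]
    have h4 : vectorFunctional u 1 / lam = ∫ t in Set.Ioi (0 : ℝ),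
        Real.exp (-(lam * t)) * vectorFunctional u (E t.toNNReal) := by
      rw [div_eq_iff hlam.ne', mul_comm]; exact h3
    rw [h4, sub_self]
  -- A nonnegative integrand of integral zero vanishes almost everywhere, hence at some `s > t`.
  -- There `E s` has full value at `u`, and so does the larger `E t`.
  have hae := (integral_eq_zero_iff_of_nonneg hg0 hgi).1 hgint
  have hae2 : ∀ᵐ s ∂(volume.restrict (Set.Ioi (t : ℝ))), g s = 0 :=
    ae_restrict_of_ae_restrict_of_subset (Set.Ioi_subset_Ioi (NNReal.coe_nonneg t)) hae
  have hae3 : ∀ᵐ s ∂(volume.restrict (Set.Ioi (t : ℝ))), s ∈ Set.Ioi (t : ℝ) :=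
    ae_restrict_mem measurableSet_Ioi
  have hne : NeBot (ae (volume.restrict (Set.Ioi (t : ℝ)))) := by
    rw [ae_neBot, Ne, Measure.restrict_eq_zero, Real.volume_Ioi]
    exact ENNReal.top_ne_zero
  obtain ⟨s, hs, hst⟩ := (hae2.and hae3).exists
  have h5 : vectorFunctional u 1 - vectorFunctional u (E s.toNNReal) = 0 :=
    (mul_eq_zero.1 hs).resolve_left (Real.exp_pos _).ne'
  have h6 : t ≤ s.toNNReal := NNReal.le_toNNReal_of_coe_le (le_of_lt hst)
  have h7 : vectorFunctional u (E s.toNNReal) ≤ vectorFunctional u (E t) :=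
    re_inner_mono (hE.antitone h6) u
  linarith

end FormalGenerator
end MinimalQDS

end

/-! ### Assembly of the theorem. -/

open MinimalQDS MinimalQDS.FormalGenerator in
theorem corollary3p2 {H : Type*} [NormedAddCommGroup H] [InnerProductSpace ℂ H] [CompleteSpace H]
    [TopologicalSpace.SeparableSpace H] (L : MinimalQDS.FormalGenerator H)
    (hL : ∀ u v : L.G.domain, L.form 1 u v = 0) (lam : ℝ) (hlam : 0 < lam) :
    L.ell lam = 0 ∧
      ∃ S : H →L[ℂ] H,
        MinimalQDS.TendstoStrong (fun n => (L.Q lam)^[n] 1) S ∧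
        MinimalQDS.TendstoUltraweak (fun n => (L.Q lam)^[n] 1) S ∧
        MinimalQDS.IsLaplaceTransform lam L.explosion (((lam : ℂ)⁻¹) • S) ∧
        (L.IsConservative ↔ S = 0) := by
  have hD := iter_isDecay hL
  choose X hX using fun n => (hD n).exists_average hlam
  obtain ⟨Y, hY⟩ := (Pmin_isDecay hL).exists_average hlam
  -- The convention `P⁽⁰⁾ = 0` makes `1 - X 0 = 1`, so the iterates of `Q_λ` start at `n = 0` with
  -- no shift of index.
  have hX0 : X 0 = 0 := by
    refine op_eq_of_dense_re (e := id) denseRange_id (hX 0).nonneg le_rfl fun u => ?_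
    have h1 := (hX 0).vectorFunctional_eq hlam (hD 0) u
    simp only [iter, map_zero, mul_zero, integral_zero] at h1
    simpa [vectorFunctional_apply] using h1
  have hQ : ∀ n, L.Q lam (1 - X n) = 1 - X (n + 1) := fun n =>
    Q_one_sub hL hlam (hD n) (hD (n + 1)) (iter_isNext hL n) (hX n) (hX (n + 1))
  have hiter : ∀ n, (L.Q lam)^[n] 1 = 1 - X n := fun n => by
    induction n with
    | zero => rw [hX0, sub_zero]; rfl
    | succ n ih => rw [Function.iterate_succ_apply', ih, hQ]
  have hA0 : ∀ n, 0 ≤ 1 - X n := fun n => sub_nonneg.2 (hX n).le_one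
  have hA1 : ∀ n, 1 - X n ≤ 1 := fun n => sub_le_self _ (hX n).nonneg
  have hanti : Antitone fun n => 1 - X n := fun m n h =>
    sub_le_sub_left (average_mono hlam (hD m) (hD n) (fun t => iter_monotone hL t h)
      (hX m) (hX n)) 1
  obtain ⟨S, hS0, -, hS⟩ := exists_strong_limit hanti hA0 hA1
  have hSY : S = 1 - Y := by
    refine op_eq_of_dense_re (e := id) denseRange_id hS0 (sub_nonneg.2 hY.le_one) fun u => ?_
    have h1 : Tendsto (fun n => vectorFunctional u (1 - X n)) atTop (𝓝 (vectorFunctional u S)) :=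
      (Complex.continuous_re.tendsto _).comp (tendsto_const_nhds.inner (hS u))
    have h2 := (tendsto_average hL hlam hX hY u).const_sub (vectorFunctional u 1)
    simp only [← map_sub] at h2
    exact tendsto_nhds_unique h1 h2
  have hlap : IsLaplaceTransform lam L.explosion ((lam : ℂ)⁻¹ • S) := by
    rw [hSY]
    exact hY.isLaplaceTransform_one_sub hlam
  have hl : (lam : ℂ) ≠ 0 := Complex.ofReal_ne_zero.2 hlam.ne'
  refine ⟨?_, S, ?_, ?_, hlap, ?_⟩
  -- `ℓ_λ(I) = 0` is the case `n = 0` of the recursion: `Q_λ(I) = 1 - X 1` is `λ` times the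
  -- transform of `I - P⁽¹⁾_t(I)`.
  · have h1 : laplaceTransform lam (L.explosionIter 1) = (lam : ℂ)⁻¹ • (1 - X 1) :=
      ((hX 1).isLaplaceTransform_one_sub hlam).laplaceTransform_eq
    have h2 := hQ 0
    rw [hX0, sub_zero, zero_add] at h2
    rw [ell, h1, h2, sub_self]
  · simp only [hiter]
    exact hS
  · simp only [hiter]
    exact hS.tendstoUltraweak hA0 hA1
  · constructor
    · intro hcons
      have h0 : IsLaplaceTransform lam L.explosion 0 := fun u v => by
        have : ∀ t : ℝ≥0, L.explosion t = 0 := fun t => by rw [explosion, hcons t, sub_self]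
        simp [this]
      exact (smul_eq_zero.1 (hlap.unique h0)).resolve_left (inv_ne_zero hl)
    · intro hz t
      have hY1 : Y = 1 := by rw [hz] at hSY; exact (sub_eq_zero.1 hSY.symm).symm
      rw [hY1] at hY
      exact eq_one_of_average_one hlam (Pmin_isDecay hL) hY t
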